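/- Let $\mathcal E$ be a category with finite limits. A morphism $f\colon B\to A$ of $\mathcal E$ is *exponentiable* if the pullback functor $\Delta_f\colon \mathcal E/A\to\mathcal E/B$ has a right adjoint $\Pi_f$; write $\Sigma_f$ for the left adjoint of $\Delta_f$ (composition with $f$). **The category $\mathbf{Poly}_{\mathcal E}$.** Its objects (polynomials) are the exponentiable morphisms $p\colon P_*\to P$ of $\mathcal E$. A morphism $\varphi\colon p\to q$, where $q\colon Q_*\to Q$, is a pair of a morphism $\varphi_1\colon P\to Q$ and a morphism $\varphi^\sharp\colon P\times_Q Q_*\to P_*$ over $P$ (pairs over different choices of the pullback being identified along the canonical isomorphism). The composite of $\varphi\colon p\to q$ and $\psi\colon q\to r$ is $\psi_1\varphi_1$ together with $P\times_R R_*\cong P\times_Q(Q\times_R R_*)\xrightarrow{P\times_Q\psi^\sharp}P\times_Q Q_*\xrightarrow{\varphi^\sharp}P_*$. Let $y=\mathrm{id}_1$, and let $p\triangleleft q$ be the polynomial with base $\Pi_p(Q\times P_*)$ given by the composite $$\big(\Pi_p(Q\times P_*)\times_P P_*\big)\times_Q Q_*\to \Pi_p(Q\times P_*)\times_P P_*\to\Pi_p(Q\times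 P_*),$$ where $\Pi_p(Q\times P_*)\times_P P_*\to Q\times P_*\to Q$ is the counit of $\Delta_p\dashv\Pi_p$ followed by the projection. **Polynomial functors.** For a polynomial $p$ put $P(p)=\big(\mathcal E\xrightarrow{\Delta_!}\mathcal E/P_*\xrightarrow{\Pi_p}\mathcal E/P\xrightarrow{\Sigma_!}\mathcal E\big)$, where $!$ is the morphism to the terminal object. Thus a morphism $T\to P(p)(A)$ amounts to a pair of morphisms $T\to P$ and $T\times_P P_*\to A$. For $\varphi\colon p\to q$ let $P(\varphi)\colon P(p)\to P(q)$ be the composite of the following two transformations, where $w=\varphi^\sharp$ and $q'=p\,w\colon P\times_Q Q_*\to P$ is the pullback of $q$ along $\varphi_1$. * The vertical part $P(p)\to P(q')$ is $\Sigma_!$ applied to $$\Pi_p\Delta_!\to\Pi_{q'}\Delta_{q'}\Pi_p\Delta_!\cong\Pi_{q'}\Delta_w\Delta_p\Pi_p\Delta_!\to\Pi_{q'}\Delta_w\Delta_!\cong\Pi_{q'}\Delta_!,$$ given by the unit of $\Delta_{q'}\dashv\Pi_{q'}$ and the counit of $\Delta_p\dashv\Pi_p$; exponentiability of $w$ is not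 needed. * The cartesian part $P(q')\to P(q)$ is $$\Sigma_!\Pi_{q'}\Delta_!\cong\Sigma_!\Pi_{q'}\Delta_u\Delta_!\cong\Sigma_!\Delta_{\varphi_1}\Pi_q\Delta_!\cong\Sigma_!\Sigma_{\varphi_1}\Delta_{\varphi_1}\Pi_q\Delta_!\to\Sigma_!\Pi_q\Delta_!,$$ where $u\colon P\times_Q Q_*\to Q_*$ is the projection, the second isomorphism is the Beck–Chevalley isomorphism, the third is $\Sigma_!\cong\Sigma_!\Sigma_{\varphi_1}$, and the last arrow is the counit of $\Sigma_{\varphi_1}\dashv\Delta_{\varphi_1}$. **Strong endofunctors.** A *strength* on $F\colon\mathcal E\to\mathcal E$ is a family $\tau_{A,B}\colon A\times F(B)\to F(A\times B)$, natural in $A$ and $B$, such that, up to the coherence isomorphisms for products, $\tau_{1,B}=\mathrm{id}_{F(B)}$ and $\tau_{A\times A',B}=\tau_{A,A'\times B}\circ(\mathrm{id}_A\times\tau_{A',B})$. A natural transformation $\psi\colon (F,\tau)\to(F',\tau')$ is *strong* if $\tau'_{A,B}\circ(\mathrm{id}_A\times\psi_B)=\psi_{A\times B}\circ\tau_{A,B}$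 for all $A,B$. Let $\mathbf{StrFun}(\mathcal E,\mathcal E)$ be the category of endofunctors of $\mathcal E$ equipped with a strength and strong natural transformations, monoidal under composition $F\otimes G=F\circ G$ (with strength $F(\tau^G_{A,B})\circ\tau^F_{A,G(B)}$). Each $P(p)$ has the canonical strength $A\times P(p)(B)\to P(p)(A\times B)$ which keeps the position in $P$ and sends a direction to the pair of the given element of $A$ and the value in $B$. **Theorem.** For every category $\mathcal E$ with finite limits, the assignment $p\mapsto P(p)$, $\varphi\mapsto P(\varphi)$ is a functor $$P\colon\mathbf{Poly}_{\mathcal E}\to\mathbf{StrFun}(\mathcal E,\mathcal E)$$ which is full and faithful. Moreover, $P$ is a monoidal functor: there is exactly one structure of monoidal category on $\mathbf{Poly}_{\mathcal E}$ with product $\triangleleft$ on objects and unit $y$ for which $P$ is a (strong) monoidal functor with the following canonical comparison morphisms, all of which are then isomorphisms. The unit comparison $A\to P(y)(A)$ corresponds to the projection $A\times_1 1\to A$. The comparison $P(p)(P(q)(A))\to P(p\triangleleft q)(A)$ has as its component to the base $\Pi_p(Q\times P_*)=P(p)(Q)$ the morphism $P(p)$ applied to the projection $P(q)(A)\to Q$,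 and sends a direction, that is a compatible pair of a direction of $p$ and a direction of $q$, to the result of evaluating at the first and then at the second. -/

import Mathlib

open CategoryTheory CategoryTheory.Limits

universe v u

noncomputable section

namespace CatPoly

attribute [local simp] pullback.lift_fst pullback.lift_snd pullback.lift_fst_assoc
  pullback.lift_snd_assoc prod.lift_fst prod.lift_snd prod.lift_fst_assoc prod.lift_snd_assoc

variable {E : Type u} [Category.{v} E] [HasFiniteLimits E]

/-- A morphism `f : B ⟶ A` is exponentiable if the pullback functor `E/A ⥤ E/B` has a right
adjoint. -/
abbrev Exponentiable {B A : E} (f : B ⟶ A) : Prop :=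
  (Over.pullback f).IsLeftAdjoint

/-- The right adjoint `Π_f` of the pullback functor along an exponentiable morphism. -/
abbrev pushforward {B A : E} (f : B ⟶ A) [Exponentiable f] : Over B ⥤ Over A :=
  (Over.pullback f).rightAdjoint

/-- The adjunction `Δ_f ⊣ Π_f`. -/
abbrev pushAdj {B A : E} (f : B ⟶ A) [Exponentiable f] :
    Over.pullback f ⊣ pushforward f :=
  Adjunction.ofIsLeftAdjoint (Over.pullback f)

lemma exponentiable_id (A : E) : Exponentiable (𝟙 A) :=
  Functor.isLeftAdjoint_of_iso (Over.pullbackId (X := A)).symm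

lemma exponentiable_comp {C B A : E} (g : C ⟶ B) (f : B ⟶ A) [Exponentiable g]
    [Exponentiable f] : Exponentiable (g ≫ f) :=
  Functor.isLeftAdjoint_of_iso (Over.pullbackComp g f).symm

/-- Exponentiable morphisms are stable under pullback. -/
instance exponentiable_pullback {A' B A : E} (a : A' ⟶ A) (f : B ⟶ A) [Exponentiable f] :
    Exponentiable (pullback.fst a f) := by
  let F : Over A' ⥤ Over (pullback a f) :=
    (Over.mk a).iteratedSliceBackward ⋙ Over.post (Over.pullback f) ⋙
      ((Over.pullback f).obj (Over.mk a)).iteratedSliceForward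
  have h1 : (Over.mk a).iteratedSliceBackward.IsLeftAdjoint :=
    inferInstanceAs (Over.mk a).iteratedSliceEquiv.inverse.IsLeftAdjoint
  have h2 : ((Over.pullback f).obj (Over.mk a)).iteratedSliceForward.IsLeftAdjoint :=
    inferInstanceAs ((Over.pullback f).obj (Over.mk a)).iteratedSliceEquiv.functor.IsLeftAdjoint
  have : F.IsLeftAdjoint := inferInstance
  have k1 {Y : E} (y : Y ⟶ A') : (pullbackRightPullbackFstIso a f y).hom ≫
        pullback.lift (pullback.fst (y ≫ a) f ≫ y) (pullback.snd (y ≫ a) f)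
          (by simp [pullback.condition]) = pullback.snd y (pullback.fst a f) := by
    apply pullback.hom_ext
    · simp [← pullback.condition]
    · simp
  have k2 {X Y : E} (x : X ⟶ A') (y : Y ⟶ A') (g : X ⟶ Y) (w : g ≫ y = x) :
      (pullbackRightPullbackFstIso a f x).hom ≫
          pullback.lift (pullback.fst (x ≫ a) f ≫ g) (pullback.snd (x ≫ a) f)
            (by simp [← pullback.condition, reassoc_of% w]) =
        pullback.lift (pullback.fst x (pullback.fst a f) ≫ g)
          (pullback.snd x (pullback.fst a f)) (by simp [w, pullback.condition]) ≫
          (pullbackRightPullbackFstIso a f y).hom := by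
    apply pullback.hom_ext <;> simp
  let e : F ≅ Over.pullback (pullback.fst a f) := NatIso.ofComponents
    (fun Y => (Over.isoMk (pullbackRightPullbackFstIso a f Y.hom) (k1 Y.hom)).symm)
    (fun {X Y} g => by
      rw [Iso.symm_hom, Iso.symm_hom, Iso.comp_inv_eq, Category.assoc, Iso.eq_inv_comp]
      ext
      exact k2 X.hom Y.hom g.left (Over.w g))
  exact Functor.isLeftAdjoint_of_iso e

/-- The functor `A ↦ (A × X ⟶ X)` from `E` to `E/X`, that is, pullback along `X ⟶ 1`. -/
@[simps]
def prodOver (X : E) : E ⥤ Over X where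
  obj A := Over.mk (prod.snd : A ⨯ X ⟶ X)
  map f := Over.homMk (prod.map f (𝟙 X)) (by simp)
  map_id A := by ext; simp
  map_comp f g := by ext; simp

/-- The counit `Δ_f Π_f Z ⟶ Z`, as a morphism of `E`. -/
def evMap {B A : E} (f : B ⟶ A) [Exponentiable f] (Z : Over B) :
    pullback ((pushforward f).obj Z).hom f ⟶ Z.left :=
  ((pushAdj f).counit.app Z).left

lemma evMap_hom {B A : E} (f : B ⟶ A) [Exponentiable f] (Z : Over B) :
    evMap f Z ≫ Z.hom = pullback.snd _ _ :=
  Over.w ((pushAdj f).counit.app Z)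

/-- Evaluation of a generalized element of `Π_f Z` at a generalized element of `B`. -/
def evalAt {B A : E} (f : B ⟶ A) [Exponentiable f] (Z : Over B) {T : E}
    (x : T ⟶ ((pushforward f).obj Z).left) (d : T ⟶ B)
    (h : x ≫ ((pushforward f).obj Z).hom = d ≫ f) : T ⟶ Z.left :=
  pullback.lift x d h ≫ evMap f Z

lemma evalAt_hom {B A : E} (f : B ⟶ A) [Exponentiable f] (Z : Over B) {T : E}
    (x : T ⟶ ((pushforward f).obj Z).left) (d : T ⟶ B)
    (h : x ≫ ((pushforward f).obj Z).hom = d ≫ f) : evalAt f Z x d h ≫ Z.hom = d := by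
  rw [evalAt, Category.assoc, evMap_hom, pullback.lift_snd]

lemma comp_evalAt {B A : E} (f : B ⟶ A) [Exponentiable f] (Z : Over B) {S T : E} (a : S ⟶ T)
    (x : T ⟶ ((pushforward f).obj Z).left) (d : T ⟶ B)
    (h : x ≫ ((pushforward f).obj Z).hom = d ≫ f) :
    a ≫ evalAt f Z x d h = evalAt f Z (a ≫ x) (a ≫ d) (by simp [h]) := by
  rw [evalAt, evalAt, ← Category.assoc]
  congr 1
  apply pullback.hom_ext <;> simp

lemma evalAt_homEquiv {B A : E} (f : B ⟶ A) [Exponentiable f] {Z : Over B} {X : Over A} {T : E}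
    (y : X ⟶ (pushforward f).obj Z) (t : (Over.pullback f).obj X ⟶ Z)
    (hy : y = (pushAdj f).homEquiv X Z t) (x : T ⟶ X.left) (d : T ⟶ B)
    (h : x ≫ X.hom = d ≫ f)
    (h' : (x ≫ y.left) ≫ ((pushforward f).obj Z).hom = d ≫ f) :
    evalAt f Z (x ≫ y.left) d h' =
      pullback.lift x d h ≫ (show pullback X.hom f ⟶ Z.left from t.left) := by
  have e := (pushAdj f).homEquiv_counit X Z y
  rw [(Equiv.symm_apply_eq _).2 hy] at e
  have w : y.left ≫ ((pushforward f).obj Z).hom = X.hom := Over.w _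
  have e' : (show pullback X.hom f ⟶ Z.left from t.left) =
      pullback.lift (pullback.fst _ _ ≫ y.left) (pullback.snd _ _)
        (by rw [Category.assoc, w, pullback.condition]) ≫ evMap f Z :=
    congrArg (fun k => k.left) e
  rw [e', evalAt, ← Category.assoc]
  congr 1
  apply pullback.hom_ext <;> simp

/-- Two generalized elements of `Π_f Z` over the same element of the base agree as soon as all
their evaluations do. -/
lemma pushforward_hom_ext {B A : E} (f : B ⟶ A) [Exponentiable f] {Z : Over B} {T : E}
    (x y : T ⟶ ((pushforward f).obj Z).left)
    (h : x ≫ ((pushforward f).obj Z).hom = y ≫ ((pushforward f).obj Z).hom)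
    (H : ∀ (S : E) (a : S ⟶ T) (d : S ⟶ B) (hx : (a ≫ x) ≫ ((pushforward f).obj Z).hom = d ≫ f)
      (hy : (a ≫ y) ≫ ((pushforward f).obj Z).hom = d ≫ f),
      evalAt f Z (a ≫ x) d hx = evalAt f Z (a ≫ y) d hy) : x = y := by
  let X : Over A := Over.mk (x ≫ ((pushforward f).obj Z).hom)
  let x' : X ⟶ (pushforward f).obj Z := Over.homMk x rfl
  let y' : X ⟶ (pushforward f).obj Z := Over.homMk y h.symm
  suffices x' = y' from congrArg (fun k => k.left) this
  apply ((pushAdj f).homEquiv X Z).symm.injective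
  rw [Adjunction.homEquiv_counit, Adjunction.homEquiv_counit]
  ext
  have := H (pullback X.hom f) (pullback.fst _ _) (pullback.snd _ _)
    (by rw [Category.assoc]; exact pullback.condition)
    (by rw [Category.assoc, ← h]; exact pullback.condition)
  exact this

/-- Evaluation is compatible with the functor `Π_f`. -/
lemma evalAt_map {B A : E} (f : B ⟶ A) [Exponentiable f] {Z W : Over B} (k : Z ⟶ W) {T : E}
    (x : T ⟶ ((pushforward f).obj Z).left) (d : T ⟶ B)
    (h : x ≫ ((pushforward f).obj Z).hom = d ≫ f)
    (h' : (x ≫ ((pushforward f).map k).left) ≫ ((pushforward f).obj W).hom = d ≫ f) :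
    evalAt f W (x ≫ ((pushforward f).map k).left) d h' = evalAt f Z x d h ≫ k.left := by
  have e := congrArg (fun k => k.left) ((pushAdj f).counit.naturality k)
  have w : ((pushforward f).map k).left ≫ ((pushforward f).obj W).hom =
    ((pushforward f).obj Z).hom := Over.w _
  have e' : pullback.lift (pullback.fst _ _ ≫ ((pushforward f).map k).left) (pullback.snd _ _)
        (by rw [Category.assoc, w, pullback.condition]) ≫ evMap f W =
      evMap f Z ≫ k.left := e
  rw [evalAt, evalAt, Category.assoc, ← e', ← Category.assoc]
  congr 1
  apply pullback.hom_ext <;> simp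

/-- The canonical isomorphism `Δ_{wf} ≅ Δ_w Δ_f`. -/
def pullbackCompHom {Y X B : E} (w : Y ⟶ X) (f : X ⟶ B) :
    Over.pullback (w ≫ f) ⟶ Over.pullback f ⋙ Over.pullback w where
  app Z := Over.homMk
    (show pullback Z.hom (w ≫ f) ⟶ pullback (pullback.snd Z.hom f) w from
      pullback.lift (pullback.lift (pullback.fst _ _) (pullback.snd _ _ ≫ w)
        (by rw [Category.assoc]; exact pullback.condition)) (pullback.snd _ _) (by simp))
    (pullback.lift_snd _ _ _)
  naturality Z W k := by
    have key {U V : E} (z : U ⟶ B) (v : V ⟶ B) (k : U ⟶ V) (hk : k ≫ v = z) :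
        pullback.lift (pullback.fst z (w ≫ f) ≫ k) (pullback.snd z (w ≫ f))
            (by rw [Category.assoc, hk, pullback.condition]) ≫
          (pullback.lift (pullback.lift (pullback.fst v (w ≫ f)) (pullback.snd v (w ≫ f) ≫ w)
            (by rw [Category.assoc, pullback.condition])) (pullback.snd v (w ≫ f)) (by simp) :
            pullback v (w ≫ f) ⟶ pullback (pullback.snd v f) w) =
        (pullback.lift (pullback.lift (pullback.fst z (w ≫ f)) (pullback.snd z (w ≫ f) ≫ w)
            (by rw [Category.assoc, pullback.condition])) (pullback.snd z (w ≫ f)) (by simp) :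
            pullback z (w ≫ f) ⟶ pullback (pullback.snd z f) w) ≫
          pullback.lift (pullback.fst (pullback.snd z f) w ≫
            pullback.lift (pullback.fst z f ≫ k) (pullback.snd z f)
              (by rw [Category.assoc, hk, pullback.condition]))
            (pullback.snd (pullback.snd z f) w) (by simp [pullback.condition]) := by
      refine pullback.hom_ext (pullback.hom_ext ?_ ?_) ?_ <;> simp
    ext
    exact key Z.hom W.hom k.left (Over.w k)

/-- The canonical isomorphism `Δ_w (A × X) ≅ A × Y` over `Y`. -/
def pullbackProdOver {Y X : E} (w : Y ⟶ X) : prodOver X ⋙ Over.pullback w ⟶ prodOver Y where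
  app A := Over.homMk
    (show pullback (prod.snd : A ⨯ X ⟶ X) w ⟶ A ⨯ Y from
      prod.lift (pullback.fst _ _ ≫ prod.fst) (pullback.snd _ _)) (prod.lift_snd _ _)
  naturality A B k := by
    have key : pullback.lift (pullback.fst (prod.snd : A ⨯ X ⟶ X) w ≫ prod.map k (𝟙 X))
          (pullback.snd (prod.snd : A ⨯ X ⟶ X) w) (by simp [pullback.condition]) ≫
        prod.lift (pullback.fst (prod.snd : B ⨯ X ⟶ X) w ≫ prod.fst)
          (pullback.snd (prod.snd : B ⨯ X ⟶ X) w) =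
        prod.lift (pullback.fst (prod.snd : A ⨯ X ⟶ X) w ≫ prod.fst)
          (pullback.snd (prod.snd : A ⨯ X ⟶ X) w) ≫ prod.map k (𝟙 Y) := by
      apply prod.hom_ext <;> simp
    ext
    exact key

/-- The canonical isomorphism `A × Y ≅ Δ_w (A × X)` over `Y`. -/
def prodOverPullback {Y X : E} (w : Y ⟶ X) : prodOver Y ⟶ prodOver X ⋙ Over.pullback w where
  app A := Over.homMk
    (show A ⨯ Y ⟶ pullback (prod.snd : A ⨯ X ⟶ X) w from
      pullback.lift (prod.map (𝟙 A) w) prod.snd (by simp)) (pullback.lift_snd _ _ _)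
  naturality A B k := by
    have key : prod.map k (𝟙 Y) ≫
          pullback.lift (f := (prod.snd : B ⨯ X ⟶ X)) (g := w) (prod.map (𝟙 B) w) prod.snd
            (by simp) =
        pullback.lift (f := (prod.snd : A ⨯ X ⟶ X)) (g := w) (prod.map (𝟙 A) w) prod.snd
            (by simp) ≫
          pullback.lift (pullback.fst (prod.snd : A ⨯ X ⟶ X) w ≫ prod.map k (𝟙 X))
            (pullback.snd (prod.snd : A ⨯ X ⟶ X) w) (by simp [pullback.condition]) := by
      apply pullback.hom_ext <;> simp
    ext
    exact key

/-- For `f' = w ≫ f`, the natural transformation `Π_f Δ_! ⟶ Π_{f'} Δ_!` given by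
`Π_f Δ_! ⟶ Π_{f'} Δ_{f'} Π_f Δ_! ≅ Π_{f'} Δ_w Δ_f Π_f Δ_! ⟶ Π_{f'} Δ_w Δ_! ≅ Π_{f'} Δ_!`,
the first arrow being the unit of `Δ_{f'} ⊣ Π_{f'}` and the third one the counit of
`Δ_f ⊣ Π_f`. No exponentiability of `w` is involved. -/
def verticalTrans {Y X B : E} (w : Y ⟶ X) (f : X ⟶ B) [Exponentiable f]
    [Exponentiable (w ≫ f)] :
    prodOver X ⋙ pushforward f ⟶ prodOver Y ⋙ pushforward (w ≫ f) :=
  Functor.whiskerLeft (prodOver X ⋙ pushforward f) (pushAdj (w ≫ f)).unit ≫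
  Functor.whiskerRight
    (Functor.whiskerLeft (prodOver X ⋙ pushforward f) (pullbackCompHom w f) ≫
      Functor.whiskerRight (Functor.whiskerLeft (prodOver X) (pushAdj f).counit)
        (Over.pullback w) ≫ pullbackProdOver w)
    (pushforward (w ≫ f))

/-- For a pullback square, the canonical isomorphism `Δ_f Σ_v ≅ Σ_u Δ_{f'}`. -/
def baseChange {Y' Y B' B : E} {u : Y' ⟶ Y} {f' : Y' ⟶ B'} {f : Y ⟶ B} {v : B' ⟶ B}
    (sq : IsPullback u f' f v) :
    Over.map v ⋙ Over.pullback f ⟶ Over.pullback f' ⋙ Over.map u where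
  app Z := Over.homMk
    (show pullback (Z.hom ≫ v) f ⟶ pullback Z.hom f' from
      pullback.lift (pullback.fst _ _)
        (sq.lift (pullback.snd _ _) (pullback.fst _ _ ≫ Z.hom)
          (by rw [Category.assoc]; exact pullback.condition.symm)) (by simp))
    (by
      have key {V : E} (z : V ⟶ B') (h1 : pullback.snd (z ≫ v) f ≫ f =
          (pullback.fst (z ≫ v) f ≫ z) ≫ v) (h2 : pullback.fst (z ≫ v) f ≫ z =
          sq.lift (pullback.snd (z ≫ v) f) (pullback.fst (z ≫ v) f ≫ z) h1 ≫ f') :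
          pullback.lift (pullback.fst (z ≫ v) f) (sq.lift (pullback.snd (z ≫ v) f)
            (pullback.fst (z ≫ v) f ≫ z) h1) h2 ≫ pullback.snd z f' ≫ u =
          pullback.snd (z ≫ v) f := by simp
      exact key Z.hom _ _)
  naturality Z W k := by
    have key {V V' : E} (z : V ⟶ B') (z' : V' ⟶ B') (k : V ⟶ V') (hk : k ≫ z' = z)
        (h1 : pullback.snd (z ≫ v) f ≫ f = (pullback.fst (z ≫ v) f ≫ z) ≫ v)
        (h2 : pullback.fst (z ≫ v) f ≫ z =
          sq.lift (pullback.snd (z ≫ v) f) (pullback.fst (z ≫ v) f ≫ z) h1 ≫ f')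
        (h1' : pullback.snd (z' ≫ v) f ≫ f = (pullback.fst (z' ≫ v) f ≫ z') ≫ v)
        (h2' : pullback.fst (z' ≫ v) f ≫ z' =
          sq.lift (pullback.snd (z' ≫ v) f) (pullback.fst (z' ≫ v) f ≫ z') h1' ≫ f')
        (h3 : (pullback.fst (z ≫ v) f ≫ k) ≫ z' ≫ v = pullback.snd (z ≫ v) f ≫ f)
        (h4 : (pullback.fst z f' ≫ k) ≫ z' = pullback.snd z f' ≫ f') :
        pullback.lift (pullback.fst (z ≫ v) f ≫ k) (pullback.snd (z ≫ v) f) h3 ≫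
          pullback.lift (pullback.fst (z' ≫ v) f) (sq.lift (pullback.snd (z' ≫ v) f)
            (pullback.fst (z' ≫ v) f ≫ z') h1') h2' =
        pullback.lift (pullback.fst (z ≫ v) f) (sq.lift (pullback.snd (z ≫ v) f)
            (pullback.fst (z ≫ v) f ≫ z) h1) h2 ≫
          pullback.lift (pullback.fst z f' ≫ k) (pullback.snd z f') h4 := by
      apply pullback.hom_ext
      · simp
      · apply sq.hom_ext <;> simp [hk]
    ext
    exact key Z.hom W.hom k.left (Over.w k) _ _ _ _ _ _

/-- For a pullback square, the Beck-Chevalley isomorphism `Π_{f'} Δ_u ≅ Δ_v Π_f`, the conjugate of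
`Δ_f Σ_v ≅ Σ_u Δ_{f'}`. -/
def beckChevalley {Y' Y B' B : E} {u : Y' ⟶ Y} {f' : Y' ⟶ B'} {f : Y ⟶ B} {v : B' ⟶ B}
    (sq : IsPullback u f' f v) [Exponentiable f] [Exponentiable f'] :
    Over.pullback u ⋙ pushforward f' ⟶ pushforward f ⋙ Over.pullback v :=
  conjugateEquiv ((pushAdj f').comp (Over.mapPullbackAdj u))
    ((Over.mapPullbackAdj v).comp (pushAdj f)) (baseChange sq)

/-- The natural transformation `Σ_! Π_{f'} Δ_! ⟶ Σ_! Π_f Δ_!` of a pullback square, given by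
`Σ_! Π_{f'} Δ_! ≅ Σ_! Π_{f'} Δ_u Δ_! ≅ Σ_! Δ_v Π_f Δ_! = Σ_! Σ_v Δ_v Π_f Δ_! ⟶ Σ_! Π_f Δ_!`,
the last arrow being the counit of `Σ_v ⊣ Δ_v`. -/
def cartesianTrans {Y' Y B' B : E} {u : Y' ⟶ Y} {f' : Y' ⟶ B'} {f : Y ⟶ B} {v : B' ⟶ B}
    (sq : IsPullback u f' f v) [Exponentiable f] [Exponentiable f'] :
    prodOver Y' ⋙ pushforward f' ⋙ Over.forget B' ⟶
      prodOver Y ⋙ pushforward f ⋙ Over.forget B :=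
  Functor.whiskerRight (prodOverPullback u) (pushforward f' ⋙ Over.forget B') ≫
  Functor.whiskerLeft (prodOver Y) (Functor.whiskerRight (beckChevalley sq) (Over.forget B')) ≫
  Functor.whiskerLeft (prodOver Y ⋙ pushforward f)
    (Functor.whiskerRight (Over.mapPullbackAdj v).counit (Over.forget B))

lemma evalAt_verticalTrans {Y X B : E} (w : Y ⟶ X) (f : X ⟶ B) [Exponentiable f]
    [Exponentiable (w ≫ f)] (A : E) {T : E}
    (x : T ⟶ ((pushforward f).obj ((prodOver X).obj A)).left) (d : T ⟶ Y)
    (h : x ≫ ((pushforward f).obj ((prodOver X).obj A)).hom = d ≫ w ≫ f)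
    (h' : (x ≫ ((verticalTrans w f).app A).left) ≫
      ((pushforward (w ≫ f)).obj ((prodOver Y).obj A)).hom = d ≫ w ≫ f) :
    evalAt (w ≫ f) ((prodOver Y).obj A) (x ≫ ((verticalTrans w f).app A).left) d h' =
      prod.lift (evalAt f ((prodOver X).obj A) x (d ≫ w) (by simpa using h) ≫ prod.fst) d := by
  have e : (verticalTrans w f).app A = (pushAdj (w ≫ f)).homEquiv _ _
      ((pullbackCompHom w f).app _ ≫
        (Over.pullback w).map ((pushAdj f).counit.app ((prodOver X).obj A)) ≫
          (pullbackProdOver w).app A) := by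
    rw [Adjunction.homEquiv_unit]
    rfl
  refine (evalAt_homEquiv (w ≫ f) _ _ e x d h h').trans ?_
  have key {V : E} (z : V ⟶ B) (ev : pullback z f ⟶ A ⨯ X) (hev : ev ≫ prod.snd = pullback.snd z f)
      (x : T ⟶ V) (h : x ≫ z = d ≫ w ≫ f) :
      pullback.lift x d h ≫
        (pullback.lift (pullback.lift (pullback.fst z (w ≫ f)) (pullback.snd z (w ≫ f) ≫ w)
            (by rw [Category.assoc, pullback.condition])) (pullback.snd z (w ≫ f)) (by simp) :
            pullback z (w ≫ f) ⟶ pullback (pullback.snd z f) w) ≫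
        pullback.lift (f := (prod.snd : A ⨯ X ⟶ X)) (g := w)
          (pullback.fst (pullback.snd z f) w ≫ ev) (pullback.snd (pullback.snd z f) w)
          (by rw [Category.assoc, hev, pullback.condition]) ≫
        prod.lift (pullback.fst (prod.snd : A ⨯ X ⟶ X) w ≫ prod.fst)
          (pullback.snd (prod.snd : A ⨯ X ⟶ X) w) =
      prod.lift ((pullback.lift x (d ≫ w) (by simpa using h) ≫ ev) ≫ prod.fst) d := by
    apply prod.hom_ext
    · simp only [Category.assoc, prod.lift_fst, pullback.lift_fst_assoc]
      simp only [← Category.assoc]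
      congr 2
      apply pullback.hom_ext <;> simp
    · simp
  exact key _ (evMap f _) (evMap_hom f _) x h

lemma beckChevalley_comp_fst_hom {Y' Y B' B : E} {u : Y' ⟶ Y} {f' : Y' ⟶ B'} {f : Y ⟶ B}
    {v : B' ⟶ B} (sq : IsPullback u f' f v) [Exponentiable f] [Exponentiable f'] (Z : Over Y) :
    (((beckChevalley sq).app Z).left ≫ pullback.fst ((pushforward f).obj Z).hom v) ≫
      ((pushforward f).obj Z).hom =
    ((pushforward f').obj ((Over.pullback u).obj Z)).hom ≫ v := by
  have w : ((beckChevalley sq).app Z).left ≫ pullback.snd ((pushforward f).obj Z).hom v =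
    ((pushforward f').obj ((Over.pullback u).obj Z)).hom := Over.w _
  have key {U V : E} (z : V ⟶ B) (b : U ⟶ pullback z v) (z' : U ⟶ B')
      (hb : b ≫ pullback.snd z v = z') : (b ≫ pullback.fst z v) ≫ z = z' ≫ v := by
    rw [← hb, Category.assoc, Category.assoc, pullback.condition]
  exact key _ _ _ w

lemma evalAt_beckChevalley {Y' Y B' B : E} {u : Y' ⟶ Y} {f' : Y' ⟶ B'} {f : Y ⟶ B}
    {v : B' ⟶ B} (sq : IsPullback u f' f v) [Exponentiable f] [Exponentiable f'] (Z : Over Y)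
    {T : E} (x : T ⟶ ((pushforward f').obj ((Over.pullback u).obj Z)).left) (d : T ⟶ Y')
    (h : x ≫ ((pushforward f').obj ((Over.pullback u).obj Z)).hom = d ≫ f')
    (h' : (x ≫ ((beckChevalley sq).app Z).left ≫
      pullback.fst ((pushforward f).obj Z).hom v) ≫ ((pushforward f).obj Z).hom = (d ≫ u) ≫ f) :
    evalAt f Z (x ≫ ((beckChevalley sq).app Z).left ≫
        pullback.fst ((pushforward f).obj Z).hom v) (d ≫ u) h' =
      (show T ⟶ pullback Z.hom u from evalAt f' ((Over.pullback u).obj Z) x d h) ≫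
        pullback.fst Z.hom u := by
  have e := conjugateEquiv_counit ((pushAdj f').comp (Over.mapPullbackAdj u))
    ((Over.mapPullbackAdj v).comp (pushAdj f)) (baseChange sq) Z
  rw [Adjunction.comp_counit_app, Adjunction.comp_counit_app, Over.mapPullbackAdj_counit_app,
    Over.mapPullbackAdj_counit_app] at e
  have e' := congrArg (fun k => k.left) e
  have key {U V W : E} (zf : V ⟶ B) (z' : U ⟶ B') (z : W ⟶ Y) (b : U ⟶ pullback zf v)
      (hb : b ≫ pullback.snd zf v = z') (ev : pullback zf f ⟶ W)
      (ev' : pullback z' f' ⟶ pullback z u)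
      (h1 : (pullback.fst (z' ≫ v) f ≫ b) ≫ pullback.snd zf v ≫ v = pullback.snd (z' ≫ v) f ≫ f)
      (h2 : (pullback.fst (pullback.snd zf v ≫ v) f ≫ pullback.fst zf v) ≫ zf =
        pullback.snd (pullback.snd zf v ≫ v) f ≫ f)
      (h3 : pullback.snd (z' ≫ v) f ≫ f = (pullback.fst (z' ≫ v) f ≫ z') ≫ v)
      (h4 : pullback.fst (z' ≫ v) f ≫ z' =
          sq.lift (pullback.snd (z' ≫ v) f) (pullback.fst (z' ≫ v) f ≫ z') h3 ≫ f')
      (e : pullback.lift (pullback.fst (z' ≫ v) f ≫ b) (pullback.snd (z' ≫ v) f) h1 ≫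
        pullback.lift (pullback.fst (pullback.snd zf v ≫ v) f ≫ pullback.fst zf v)
          (pullback.snd (pullback.snd zf v ≫ v) f) h2 ≫ ev =
        pullback.lift (pullback.fst (z' ≫ v) f) (sq.lift (pullback.snd (z' ≫ v) f)
            (pullback.fst (z' ≫ v) f ≫ z') h3) h4 ≫ ev' ≫ pullback.fst z u)
      (x : T ⟶ U) (h : x ≫ z' = d ≫ f')
      (h' : (x ≫ b ≫ pullback.fst zf v) ≫ zf = (d ≫ u) ≫ f) :
      pullback.lift (x ≫ b ≫ pullback.fst zf v) (d ≫ u) h' ≫ ev =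
        (pullback.lift x d h ≫ ev') ≫ pullback.fst z u := by
    have hx : x ≫ z' ≫ v = (d ≫ u) ≫ f := by
      rw [← Category.assoc, h, Category.assoc, Category.assoc, sq.w]
    have e2 := congrArg (fun k => pullback.lift x (d ≫ u) hx ≫ k) e
    simp only [← Category.assoc] at e2
    convert e2 using 2
    · apply pullback.hom_ext <;> simp
    · congr 1
      apply pullback.hom_ext
      · simp
      · apply sq.hom_ext <;> simp [h]
  exact key _ _ _ _ (Over.w ((beckChevalley sq).app Z)) (evMap f Z)
    (evMap f' ((Over.pullback u).obj Z)) _ _ _ _ e' x h h'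

/-- The component of `cartesianTrans` at `A`. -/
def cartesianApp {Y' Y B' B : E} {u : Y' ⟶ Y} {f' : Y' ⟶ B'} {f : Y ⟶ B}
    {v : B' ⟶ B} (sq : IsPullback u f' f v) [Exponentiable f] [Exponentiable f'] (A : E) :
    ((pushforward f').obj ((prodOver Y').obj A)).left ⟶
      ((pushforward f).obj ((prodOver Y).obj A)).left :=
  (cartesianTrans sq).app A

lemma cartesianApp_eq {Y' Y B' B : E} {u : Y' ⟶ Y} {f' : Y' ⟶ B'} {f : Y ⟶ B}
    {v : B' ⟶ B} (sq : IsPullback u f' f v) [Exponentiable f] [Exponentiable f'] (A : E) :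
    cartesianApp sq A =
      ((pushforward f').map ((prodOverPullback u).app A)).left ≫
        ((beckChevalley sq).app ((prodOver Y).obj A)).left ≫
          pullback.fst ((pushforward f).obj ((prodOver Y).obj A)).hom v := by
  have e := congrArg (fun k => k.left)
    (Over.mapPullbackAdj_counit_app v ((pushforward f).obj ((prodOver Y).obj A)))
  have e' : ((Over.mapPullbackAdj v).counit.app
      ((pushforward f).obj ((prodOver Y).obj A))).left =
      pullback.fst ((pushforward f).obj ((prodOver Y).obj A)).hom v := e
  rw [← e']
  rfl

lemma cartesianApp_hom {Y' Y B' B : E} {u : Y' ⟶ Y} {f' : Y' ⟶ B'} {f : Y ⟶ B}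
    {v : B' ⟶ B} (sq : IsPullback u f' f v) [Exponentiable f] [Exponentiable f'] (A : E) :
    cartesianApp sq A ≫ ((pushforward f).obj ((prodOver Y).obj A)).hom =
      ((pushforward f').obj ((prodOver Y').obj A)).hom ≫ v := by
  have w : ((pushforward f').map ((prodOverPullback u).app A)).left ≫
      ((pushforward f').obj ((Over.pullback u).obj ((prodOver Y).obj A))).hom =
    ((pushforward f').obj ((prodOver Y').obj A)).hom := Over.w _
  rw [cartesianApp_eq, Category.assoc, beckChevalley_comp_fst_hom, ← Category.assoc, w]

lemma evalAt_cartesianApp {Y' Y B' B : E} {u : Y' ⟶ Y} {f' : Y' ⟶ B'} {f : Y ⟶ B}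
    {v : B' ⟶ B} (sq : IsPullback u f' f v) [Exponentiable f] [Exponentiable f'] (A : E)
    {T : E} (x : T ⟶ ((pushforward f').obj ((prodOver Y').obj A)).left) (d : T ⟶ Y')
    (h : x ≫ ((pushforward f').obj ((prodOver Y').obj A)).hom = d ≫ f')
    (h' : (x ≫ cartesianApp sq A) ≫ ((pushforward f).obj ((prodOver Y).obj A)).hom =
      (d ≫ u) ≫ f) :
    evalAt f ((prodOver Y).obj A) (x ≫ cartesianApp sq A) (d ≫ u) h' =
      evalAt f' ((prodOver Y').obj A) x d h ≫ prod.map (𝟙 A) u := by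
  have w : ((pushforward f').map ((prodOverPullback u).app A)).left ≫
      ((pushforward f').obj ((Over.pullback u).obj ((prodOver Y).obj A))).hom =
    ((pushforward f').obj ((prodOver Y').obj A)).hom := Over.w _
  have h1 : (x ≫ ((pushforward f').map ((prodOverPullback u).app A)).left) ≫
      ((pushforward f').obj ((Over.pullback u).obj ((prodOver Y).obj A))).hom = d ≫ f' := by
    rw [Category.assoc, w, h]
  have e1 := evalAt_beckChevalley sq ((prodOver Y).obj A)
    (x ≫ ((pushforward f').map ((prodOverPullback u).app A)).left) d h1
    (by rw [← h', cartesianApp_eq]; simp only [Category.assoc])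
  have e2 := evalAt_map f' ((prodOverPullback u).app A) x d h h1
  have e3 : x ≫ cartesianApp sq A =
      (x ≫ ((pushforward f').map ((prodOverPullback u).app A)).left) ≫
        ((beckChevalley sq).app ((prodOver Y).obj A)).left ≫
          pullback.fst ((pushforward f).obj ((prodOver Y).obj A)).hom v := by
    rw [cartesianApp_eq]; simp only [Category.assoc]
  have e4 : evalAt f ((prodOver Y).obj A) (x ≫ cartesianApp sq A) (d ≫ u) h' =
      evalAt f ((prodOver Y).obj A) ((x ≫ ((pushforward f').map
        ((prodOverPullback u).app A)).left) ≫ ((beckChevalley sq).app ((prodOver Y).obj A)).left ≫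
          pullback.fst ((pushforward f).obj ((prodOver Y).obj A)).hom v) (d ≫ u)
          (by rw [← e3, h']) := by
    congr 1
  rw [e4, e1]
  have key (ev : T ⟶ A ⨯ Y') : (ev ≫ (pullback.lift (prod.map (𝟙 A) u) prod.snd (by simp) :
      A ⨯ Y' ⟶ pullback (prod.snd : A ⨯ Y ⟶ Y) u)) ≫ pullback.fst _ _ =
      ev ≫ prod.map (𝟙 A) u := by simp
  exact (congrArg (fun k : T ⟶ pullback (prod.snd : A ⨯ Y ⟶ Y) u => k ≫ pullback.fst _ _) e2).trans
    (key _)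

variable (E) in
/-- A polynomial in `E` is an exponentiable morphism of `E`. -/
structure Poly where
  /-- The object of positions. -/
  base : E
  /-- The object of directions. -/
  total : E
  /-- The morphism from directions to positions. -/
  hom : total ⟶ base
  /-- It is exponentiable. -/
  exp : Exponentiable hom

attribute [instance] Poly.exp

namespace Poly

/-- A morphism of polynomials from `p` to `q`: a morphism on positions, together with a
morphism on directions defined on the pullback and lying over the positions of `p`. An
isomorphism class of such data over varying choices of the pullback contains exactly one
representative over the chosen pullback. -/
@[ext]
structure Hom (p q : Poly E) where
  /-- The component on positions. -/
  onBase : p.base ⟶ q.base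
  /-- The component on directions. -/
  onTotal : pullback onBase q.hom ⟶ p.total
  /-- The component on directions is a morphism over the positions of `p`. -/
  onTotal_hom : onTotal ≫ p.hom = pullback.fst onBase q.hom

/-- The action of a morphism of polynomials on generalized directions. -/
def Hom.app {p q : Poly E} (φ : Hom p q) {T : E} (x : T ⟶ p.base) (d : T ⟶ q.total)
    (h : x ≫ φ.onBase = d ≫ q.hom) : T ⟶ p.total :=
  pullback.lift x d h ≫ φ.onTotal

lemma Hom.app_hom {p q : Poly E} (φ : Hom p q) {T : E} (x : T ⟶ p.base) (d : T ⟶ q.total)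
    (h : x ≫ φ.onBase = d ≫ q.hom) : φ.app x d h ≫ p.hom = x := by
  rw [Hom.app, Category.assoc, φ.onTotal_hom, pullback.lift_fst]

lemma Hom.comp_app {p q : Poly E} (φ : Hom p q) {S T : E} (a : S ⟶ T) (x : T ⟶ p.base)
    (d : T ⟶ q.total) (h : x ≫ φ.onBase = d ≫ q.hom) :
    a ≫ φ.app x d h = φ.app (a ≫ x) (a ≫ d) (by simp [h]) := by
  rw [Hom.app, Hom.app, ← Category.assoc]
  congr 1
  apply pullback.hom_ext <;> simp

lemma Hom.ext_app {p q : Poly E} {φ ψ : Hom p q} (h : φ.onBase = ψ.onBase)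
    (H : ∀ (T : E) (x : T ⟶ p.base) (d : T ⟶ q.total) (h₁ : x ≫ φ.onBase = d ≫ q.hom)
      (h₂ : x ≫ ψ.onBase = d ≫ q.hom), φ.app x d h₁ = ψ.app x d h₂) : φ = ψ := by
  obtain ⟨f, g, w⟩ := φ
  obtain ⟨f', g', w'⟩ := ψ
  obtain rfl : f = f' := h
  have := H _ (pullback.fst f q.hom) (pullback.snd f q.hom) pullback.condition pullback.condition
  simp only [Hom.app, pullback.lift_fst_snd, Category.id_comp] at this
  subst this
  rfl

/-- The identity morphism of a polynomial. -/
def Hom.id (p : Poly E) : Hom p p where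
  onBase := 𝟙 p.base
  onTotal := pullback.snd (𝟙 p.base) p.hom
  onTotal_hom := by rw [← pullback.condition, Category.comp_id]

/-- The composite of two morphisms of polynomials: on positions the composite, on directions
`P ×_R R_* ≅ P ×_Q (Q ×_R R_*) ⟶ P ×_Q Q_* ⟶ P_*`. -/
def Hom.comp {p q r : Poly E} (φ : Hom p q) (ψ : Hom q r) : Hom p r where
  onBase := φ.onBase ≫ ψ.onBase
  onTotal := φ.app (pullback.fst (φ.onBase ≫ ψ.onBase) r.hom)
    (ψ.app (pullback.fst (φ.onBase ≫ ψ.onBase) r.hom ≫ φ.onBase)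
      (pullback.snd (φ.onBase ≫ ψ.onBase) r.hom) (by rw [Category.assoc, pullback.condition]))
    (by rw [Hom.app_hom])
  onTotal_hom := by rw [Hom.app_hom]

lemma Hom.id_app (p : Poly E) {T : E} (x : T ⟶ p.base) (d : T ⟶ p.total)
    (h : x ≫ (Hom.id p).onBase = d ≫ p.hom) : (Hom.id p).app x d h = d :=
  pullback.lift_snd _ _ _

lemma Hom.comp_app_eq {p q r : Poly E} (φ : Hom p q) (ψ : Hom q r) {T : E} (x : T ⟶ p.base)
    (d : T ⟶ r.total) (h : x ≫ (φ.comp ψ).onBase = d ≫ r.hom) :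
    (φ.comp ψ).app x d h = φ.app x (ψ.app (x ≫ φ.onBase) d (by rw [Category.assoc]; exact h))
      (by rw [Hom.app_hom]) := by
  have h0 : x ≫ φ.onBase ≫ ψ.onBase = d ≫ r.hom := h
  change pullback.lift x d h0 ≫ φ.app _ _ _ = _
  rw [Hom.comp_app]
  congr 1
  · simp
  · rw [Hom.comp_app]
    congr 1 <;> simp

instance : Category (Poly E) where
  Hom := Hom
  id := Hom.id
  comp := Hom.comp
  id_comp φ := by
    refine Hom.ext_app (Category.id_comp _) fun T x d h₁ h₂ => ?_
    rw [Hom.comp_app_eq, Hom.id_app]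
    congr 1
    exact Category.comp_id x
  comp_id φ := by
    refine Hom.ext_app (Category.comp_id _) fun T x d h₁ h₂ => ?_
    rw [Hom.comp_app_eq]
    congr 1
    exact Hom.id_app _ _ _ _
  assoc φ ψ χ := by
    refine Hom.ext_app (Category.assoc _ _ _) fun T x d h₁ h₂ => ?_
    rw [Hom.comp_app_eq, Hom.comp_app_eq, Hom.comp_app_eq]
    congr 1
    refine Eq.trans ?_ (Hom.comp_app_eq _ _ _ _ _).symm
    congr 2
    exact (Category.assoc _ _ _).symm

@[simp] lemma id_onBase (p : Poly E) : Hom.onBase (𝟙 p) = 𝟙 p.base := rfl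

@[simp] lemma comp_onBase {p q r : Poly E} (φ : p ⟶ q) (ψ : q ⟶ r) :
    Hom.onBase (φ ≫ ψ) = Hom.onBase φ ≫ Hom.onBase ψ := rfl

/-- The polynomial endofunctor `Σ_! Π_p Δ_!` of a polynomial. -/
def functor (p : Poly E) : E ⥤ E :=
  prodOver p.total ⋙ pushforward p.hom ⋙ Over.forget p.base

/-- The projection of the polynomial functor to the object of positions. -/
def proj (p : Poly E) (A : E) : p.functor.obj A ⟶ p.base :=
  ((pushforward p.hom).obj ((prodOver p.total).obj A)).hom

/-- Evaluation of a generalized element of `p(A)` at a direction. -/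
def evAt (p : Poly E) {A T : E} (x : T ⟶ p.functor.obj A) (d : T ⟶ p.total)
    (h : x ≫ p.proj A = d ≫ p.hom) : T ⟶ A :=
  evalAt p.hom ((prodOver p.total).obj A) x d h ≫ (prod.fst : A ⨯ p.total ⟶ A)

lemma evalAt_eq (p : Poly E) {A T : E} (x : T ⟶ p.functor.obj A) (d : T ⟶ p.total)
    (h : x ≫ p.proj A = d ≫ p.hom) :
    (evalAt p.hom ((prodOver p.total).obj A) x d h : T ⟶ A ⨯ p.total) =
      prod.lift (p.evAt x d h) d := by
  apply prod.hom_ext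
  · rw [prod.lift_fst]; rfl
  · rw [prod.lift_snd]; exact evalAt_hom p.hom ((prodOver p.total).obj A) x d h

lemma comp_evAt (p : Poly E) {A S T : E} (a : S ⟶ T) (x : T ⟶ p.functor.obj A)
    (d : T ⟶ p.total) (h : x ≫ p.proj A = d ≫ p.hom) :
    a ≫ p.evAt x d h = p.evAt (a ≫ x) (a ≫ d) (by simp [h]) := by
  have key {V W : E} (ev : T ⟶ V) (ev' : S ⟶ V) (k : V ⟶ W) (e : a ≫ ev = ev') :
      a ≫ ev ≫ k = ev' ≫ k := by rw [← e, Category.assoc]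
  exact key _ _ _ (comp_evalAt p.hom ((prodOver p.total).obj A) a x d h)

lemma map_proj (p : Poly E) {A B : E} (k : A ⟶ B) :
    p.functor.map k ≫ p.proj B = p.proj A :=
  Over.w ((pushforward p.hom).map ((prodOver p.total).map k))

lemma evAt_map (p : Poly E) {A B T : E} (k : A ⟶ B) (x : T ⟶ p.functor.obj A)
    (d : T ⟶ p.total) (h : x ≫ p.proj A = d ≫ p.hom)
    (h' : (x ≫ p.functor.map k) ≫ p.proj B = d ≫ p.hom) :
    p.evAt (x ≫ p.functor.map k) d h' = p.evAt x d h ≫ k := by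
  have e := evalAt_map p.hom ((prodOver p.total).map k) x d h h'
  refine (congrArg (fun k : T ⟶ B ⨯ p.total => k ≫ prod.fst) e).trans ?_
  have key (ev : T ⟶ A ⨯ p.total) :
      (ev ≫ prod.map k (𝟙 _)) ≫ prod.fst = (ev ≫ prod.fst) ≫ k := by simp
  exact key _

/-- Generalized elements of `p(A)` with the same position agree as soon as they agree at all
directions. -/
lemma functor_hom_ext (p : Poly E) {A T : E} (x y : T ⟶ p.functor.obj A)
    (h : x ≫ p.proj A = y ≫ p.proj A)
    (H : ∀ (S : E) (a : S ⟶ T) (d : S ⟶ p.total) (hx : (a ≫ x) ≫ p.proj A = d ≫ p.hom)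
      (hy : (a ≫ y) ≫ p.proj A = d ≫ p.hom), p.evAt (a ≫ x) d hx = p.evAt (a ≫ y) d hy) :
    x = y := by
  refine pushforward_hom_ext p.hom x y h fun S a d hx hy => ?_
  refine (evalAt_eq p (a ≫ x) d hx).trans (Eq.trans ?_ (evalAt_eq p (a ≫ y) d hy).symm)
  rw [H S a d hx hy]

/-- The morphism to `p(A)` determined by a morphism `f` to positions and a morphism to `A` defined
on the pullback of `p` along `f`. -/
def lift (p : Poly E) {A T : E} (f : T ⟶ p.base) (g : pullback f p.hom ⟶ A) :
    T ⟶ p.functor.obj A :=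
  ((pushAdj p.hom).homEquiv (Over.mk f) ((prodOver p.total).obj A)
    (Over.homMk (show pullback f p.hom ⟶ A ⨯ p.total from prod.lift g (pullback.snd f p.hom))
      (prod.lift_snd _ _))).left

lemma lift_proj (p : Poly E) {A T : E} (f : T ⟶ p.base) (g : pullback f p.hom ⟶ A) :
    p.lift f g ≫ p.proj A = f :=
  Over.w ((pushAdj p.hom).homEquiv (Over.mk f) ((prodOver p.total).obj A) _)

lemma evAt_lift (p : Poly E) {A T S : E} (f : T ⟶ p.base) (g : pullback f p.hom ⟶ A)
    (a : S ⟶ T) (d : S ⟶ p.total) (h : (a ≫ p.lift f g) ≫ p.proj A = d ≫ p.hom) :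
    p.evAt (a ≫ p.lift f g) d h =
      pullback.lift a d (by rwa [Category.assoc, lift_proj] at h) ≫ g := by
  have e := evalAt_homEquiv p.hom _ _ rfl (X := Over.mk f) (Z := (prodOver p.total).obj A) a d
    (by rw [Category.assoc, lift_proj] at h; exact h) h
  refine (congrArg (fun k : S ⟶ A ⨯ p.total => k ≫ prod.fst) e).trans ?_
  have key (b : S ⟶ pullback f p.hom) :
      (b ≫ prod.lift g (pullback.snd f p.hom)) ≫ prod.fst = b ≫ g := by simp
  exact key _

instance (p q : Poly E) (φ : Hom p q) : Exponentiable (φ.onTotal ≫ p.hom) := by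
  rw [φ.onTotal_hom]; infer_instance

lemma Hom.isPullback {p q : Poly E} (φ : Hom p q) :
    IsPullback (pullback.snd φ.onBase q.hom) (φ.onTotal ≫ p.hom) q.hom φ.onBase := by
  rw [φ.onTotal_hom]; exact (IsPullback.of_hasPullback _ _).flip

/-- The natural transformation of polynomial functors induced by a morphism `φ` of polynomials:
the one of its vertical part, from `p` to the pullback of `q` along `φ₁`, followed by the one of
its cartesian part, from that pullback to `q`. -/
def trans {p q : Poly E} (φ : p ⟶ q) : p.functor ⟶ q.functor :=
  Functor.whiskerRight (verticalTrans (Hom.onTotal φ) p.hom) (Over.forget p.base) ≫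
    cartesianTrans (Hom.isPullback φ)

lemma trans_proj {p q : Poly E} (φ : p ⟶ q) (A : E) :
    (trans φ).app A ≫ q.proj A = p.proj A ≫ Hom.onBase φ := by
  have h1 := cartesianApp_hom (Hom.isPullback φ) A
  have h2 := Over.w ((verticalTrans (Hom.onTotal φ) p.hom).app A)
  have key {X Y Z P Q : E} (a : X ⟶ Y) (b : Y ⟶ Z) (pz : Z ⟶ Q) (py : Y ⟶ P) (px : X ⟶ P)
      (f : P ⟶ Q) (h1 : b ≫ pz = py ≫ f) (h2 : a ≫ py = px) : (a ≫ b) ≫ pz = px ≫ f := by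
    rw [Category.assoc, h1, ← Category.assoc, h2]
  exact key _ _ _ _ _ _ h1 h2

lemma evAt_trans {p q : Poly E} (φ : p ⟶ q) {A T : E} (x : T ⟶ p.functor.obj A)
    (d : T ⟶ q.total) (h : (x ≫ (trans φ).app A) ≫ q.proj A = d ≫ q.hom)
    (h' : (x ≫ p.proj A) ≫ Hom.onBase φ = d ≫ q.hom) :
    q.evAt (x ≫ (trans φ).app A) d h =
      p.evAt x (Hom.app φ (x ≫ p.proj A) d h') (by rw [Hom.app_hom]) := by
  let w := Hom.onTotal φ
  let y : T ⟶ ((pushforward (w ≫ p.hom)).obj ((prodOver _).obj A)).left :=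
    x ≫ ((verticalTrans w p.hom).app A).left
  let d' : T ⟶ pullback (Hom.onBase φ) q.hom := pullback.lift (x ≫ p.proj A) d h'
  have hd : d' ≫ pullback.snd (Hom.onBase φ) q.hom = d := pullback.lift_snd _ _ _
  have hw : d' ≫ w ≫ p.hom = x ≫ p.proj A :=
    (Category.assoc _ _ _).symm.trans (Hom.app_hom φ _ _ h')
  have hy : y ≫ ((pushforward (w ≫ p.hom)).obj ((prodOver _).obj A)).hom = d' ≫ w ≫ p.hom := by
    rw [hw]
    have := Over.w ((verticalTrans w p.hom).app A)
    exact (Category.assoc _ _ _).trans (congrArg (fun k => x ≫ k) this)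
  have e0 : x ≫ (trans φ).app A = y ≫ cartesianApp (Hom.isPullback φ) A :=
    (Category.assoc _ _ _).symm
  have h1 : (y ≫ cartesianApp (Hom.isPullback φ) A) ≫ q.proj A =
      (d' ≫ pullback.snd (Hom.onBase φ) q.hom) ≫ q.hom := by
    rw [hd, ← h, e0]; rfl
  have e1 := evalAt_cartesianApp (Hom.isPullback φ) A y d' hy h1
  have e2 := evalAt_verticalTrans w p.hom A x d' hw.symm hy
  have e3 : q.evAt (x ≫ (trans φ).app A) d h =
      q.evAt (y ≫ cartesianApp (Hom.isPullback φ) A)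
        (d' ≫ pullback.snd (Hom.onBase φ) q.hom) h1 := by
    congr 1
    exact hd.symm
  have key {U V : E} (a : T ⟶ A ⨯ V) (b : T ⟶ A ⨯ U) (t : T ⟶ A ⨯ p.total) (u : U ⟶ V)
      (k : T ⟶ U) (e1 : a = b ≫ prod.map (𝟙 A) u)
      (e2 : b = prod.lift (t ≫ prod.fst) k) : a ≫ prod.fst = t ≫ prod.fst := by
    rw [e1, e2]; simp
  exact e3.trans (key _ _ _ _ _ e1 e2)

lemma trans_id (p : Poly E) : trans (𝟙 p) = 𝟙 p.functor := by
  ext A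
  refine functor_hom_ext p _ _ ?_ fun S a d hx hy => ?_
  · rw [trans_proj]
    exact (Category.comp_id _).trans (Category.id_comp _).symm
  · rw [evAt_trans (𝟙 p) a d hx (by rw [← hx, Category.assoc, Category.assoc, trans_proj])]
    have e : a ≫ (𝟙 p.functor : p.functor ⟶ p.functor).app A = a := Category.comp_id a
    simp only [e]
    congr 1
    exact Hom.id_app _ _ _ _

lemma trans_comp {p q r : Poly E} (φ : p ⟶ q) (ψ : q ⟶ r) :
    trans (φ ≫ ψ) = trans φ ≫ trans ψ := by
  ext A
  refine functor_hom_ext r _ _ ?_ fun S a d hx hy => ?_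
  · rw [trans_proj, NatTrans.comp_app, Category.assoc, trans_proj, ← Category.assoc, trans_proj,
      Category.assoc]
    rfl
  · have h1 : (a ≫ p.proj A) ≫ Hom.onBase (φ ≫ ψ) = d ≫ r.hom := by
      rw [← hx, Category.assoc, Category.assoc, trans_proj]
    have h2 : ((a ≫ (trans φ).app A) ≫ q.proj A) ≫ Hom.onBase ψ = d ≫ r.hom := by
      rw [← h1, Category.assoc a, trans_proj]; simp
    have h3 : (a ≫ p.proj A) ≫ Hom.onBase φ =
        Hom.app ψ ((a ≫ (trans φ).app A) ≫ q.proj A) d h2 ≫ q.hom := by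
      rw [Hom.app_hom, Category.assoc, Category.assoc, trans_proj]
    have h4 : ((a ≫ (trans φ).app A) ≫ (trans ψ).app A) ≫ r.proj A = d ≫ r.hom := by
      rw [← hy]; simp
    rw [evAt_trans (φ ≫ ψ) a d hx h1]
    have e : a ≫ (trans φ ≫ trans ψ).app A = (a ≫ (trans φ).app A) ≫ (trans ψ).app A := by simp
    simp only [e]
    rw [evAt_trans ψ (a ≫ (trans φ).app A) d h4 h2, evAt_trans φ a _ _ h3]
    congr 1
    refine (Hom.comp_app_eq φ ψ _ _ _).trans ?_
    congr 2
    rw [Category.assoc, Category.assoc, trans_proj]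

/-- The evaluation `p(A) ×_P P_* ⟶ A`. -/
def ev (p : Poly E) (A : E) : pullback (p.proj A) p.hom ⟶ A :=
  evMap p.hom ((prodOver p.total).obj A) ≫ (prod.fst : A ⨯ p.total ⟶ A)

lemma evAt_eq_lift_ev (p : Poly E) {A T : E} (x : T ⟶ p.functor.obj A) (d : T ⟶ p.total)
    (h : x ≫ p.proj A = d ≫ p.hom) : p.evAt x d h = pullback.lift x d h ≫ p.ev A :=
  Category.assoc _ _ _

variable (E) in
/-- The identity polynomial: the identity of the terminal object. -/
def y : Poly E where
  base := ⊤_ E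
  total := ⊤_ E
  hom := 𝟙 (⊤_ E)
  exp := exponentiable_id _

/-- The composition product: the object of positions is `Π_p (Q × P_*) = p(Q)`, and the object
of directions is the pullback of `q` along `Π_p (Q × P_*) ×_P P_* ⟶ Q × P_* ⟶ Q`. -/
def tri (p q : Poly E) : Poly E where
  base := p.functor.obj q.base
  total := pullback (p.ev q.base) q.hom
  hom := pullback.fst (p.ev q.base) q.hom ≫ pullback.fst (p.proj q.base) p.hom
  exp := exponentiable_comp _ _

/-- The strength of a polynomial functor: the morphism `A × p(B) ⟶ p(A × B)` which keeps the
position and sends a direction to the pair of the given element of `A` and the value in `B`. -/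
def strength (p : Poly E) (A B : E) : A ⨯ p.functor.obj B ⟶ p.functor.obj (A ⨯ B) :=
  p.lift (prod.snd ≫ p.proj B)
    (prod.lift (pullback.fst _ _ ≫ prod.fst)
      (p.evAt (pullback.fst _ _ ≫ prod.snd) (pullback.snd _ _)
        (by rw [Category.assoc, pullback.condition])))

lemma strength_proj (p : Poly E) (A B : E) :
    p.strength A B ≫ p.proj (A ⨯ B) = prod.snd ≫ p.proj B :=
  lift_proj _ _ _

lemma evAt_strength (p : Poly E) {A B T : E} (x : T ⟶ A ⨯ p.functor.obj B)
    (d : T ⟶ p.total) (h : (x ≫ p.strength A B) ≫ p.proj (A ⨯ B) = d ≫ p.hom)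
    (h' : (x ≫ prod.snd) ≫ p.proj B = d ≫ p.hom) :
    p.evAt (x ≫ p.strength A B) d h = prod.lift (x ≫ prod.fst) (p.evAt (x ≫ prod.snd) d h') := by
  refine (evAt_lift p _ _ x d h).trans ?_
  rw [prod.comp_lift, comp_evAt]
  congr 1
  · simp
  · congr 1 <;> simp

end Poly

variable (E) in
/-- An endofunctor of `E` equipped with a strength. -/
structure StrongEndofunctor where
  /-- The underlying endofunctor. -/
  functor : E ⥤ E
  /-- The strength. -/
  strength (A B : E) : A ⨯ functor.obj B ⟶ functor.obj (A ⨯ B)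
  strength_natural {A A' B B' : E} (f : A ⟶ A') (g : B ⟶ B') :
    prod.map f (functor.map g) ≫ strength A' B' = strength A B ≫ functor.map (prod.map f g)
  strength_unit (B : E) :
    strength (⊤_ E) B ≫ functor.map (prod.leftUnitor B).hom =
      (prod.leftUnitor (functor.obj B)).hom
  strength_assoc (A A' B : E) :
    strength (A ⨯ A') B ≫ functor.map (prod.associator A A' B).hom =
      (prod.associator A A' (functor.obj B)).hom ≫
        prod.map (𝟙 A) (strength A' B) ≫ strength A (A' ⨯ B)

namespace StrongEndofunctor

/-- A strong natural transformation. -/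
@[ext]
structure Hom (F G : StrongEndofunctor E) where
  /-- The underlying natural transformation. -/
  natTrans : F.functor ⟶ G.functor
  strong (A B : E) :
    prod.map (𝟙 A) (natTrans.app B) ≫ G.strength A B =
      F.strength A B ≫ natTrans.app (A ⨯ B)

instance : Category (StrongEndofunctor E) where
  Hom := Hom
  id F := ⟨𝟙 F.functor, fun A B => by simp⟩
  comp α β := ⟨α.natTrans ≫ β.natTrans, fun A B => by
    rw [NatTrans.comp_app, NatTrans.comp_app, prod.map_id_comp, Category.assoc, β.strong,
      ← Category.assoc, α.strong, Category.assoc]⟩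
  id_comp α := Hom.ext (Category.id_comp _)
  comp_id α := Hom.ext (Category.comp_id _)
  assoc α β γ := Hom.ext (Category.assoc _ _ _)

@[ext]
lemma hom_ext {F G : StrongEndofunctor E} {α β : F ⟶ G}
    (h : ∀ A, (Hom.natTrans α).app A = (Hom.natTrans β).app A) : α = β :=
  Hom.ext (NatTrans.ext (funext h))

@[simp] lemma id_natTrans (F : StrongEndofunctor E) : Hom.natTrans (𝟙 F) = 𝟙 F.functor := rfl

@[simp] lemma comp_natTrans {F G H : StrongEndofunctor E} (α : F ⟶ G) (β : G ⟶ H) :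
    Hom.natTrans (α ≫ β) = Hom.natTrans α ≫ Hom.natTrans β := rfl

/-- The composite `A ↦ F (G A)` of strong endofunctors. -/
def comp (F G : StrongEndofunctor E) : StrongEndofunctor E where
  functor := G.functor ⋙ F.functor
  strength A B := F.strength A (G.functor.obj B) ≫ F.functor.map (G.strength A B)
  strength_natural f g := by
    have h1 := F.strength_natural f (G.functor.map g)
    have h2 := congrArg F.functor.map (G.strength_natural f g)
    rw [Functor.map_comp, Functor.map_comp] at h2
    dsimp
    rw [← Category.assoc, h1, Category.assoc, h2, Category.assoc]
  strength_unit B := by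
    have h1 := congrArg F.functor.map (G.strength_unit B)
    rw [Functor.map_comp] at h1
    have h2 := F.strength_unit (G.functor.obj B)
    dsimp at h1 h2 ⊢
    rw [Category.assoc, h1, h2]
  strength_assoc A A' B := by
    have h1 := congrArg F.functor.map (G.strength_assoc A A' B)
    have h2 := F.strength_assoc A A' (G.functor.obj B)
    have h3 := F.strength_natural (𝟙 A) (G.strength A' B)
    simp only [Functor.map_comp] at h1
    change (F.strength (A ⨯ A') (G.functor.obj B) ≫ F.functor.map (G.strength (A ⨯ A') B)) ≫
      F.functor.map (G.functor.map (prod.associator A A' B).hom) =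
      (prod.associator A A' (F.functor.obj (G.functor.obj B))).hom ≫
        prod.map (𝟙 A) (F.strength A' (G.functor.obj B) ≫ F.functor.map (G.strength A' B)) ≫
          F.strength A (G.functor.obj (A' ⨯ B)) ≫ F.functor.map (G.strength A (A' ⨯ B))
    rw [Category.assoc, h1, ← Category.assoc, h2, prod.map_id_comp]
    simp only [Category.assoc]
    rw [← Category.assoc (prod.map (𝟙 A) (F.functor.map _)), h3, Category.assoc]

/-- The identity functor with its canonical strength. -/
def unit : StrongEndofunctor E where
  functor := 𝟭 E
  strength A B := 𝟙 (A ⨯ B)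
  strength_natural f g := (Category.comp_id _).trans (Category.id_comp _).symm
  strength_unit B := Category.id_comp _
  strength_assoc A A' B := by
    change 𝟙 _ ≫ (prod.associator A A' B).hom = (prod.associator A A' B).hom ≫
      prod.map (𝟙 A) (𝟙 (A' ⨯ B)) ≫ 𝟙 _
    simp

/-- Strong natural isomorphisms from strong natural transformations which are mutually inverse. -/
def isoOfApp {F G : StrongEndofunctor E} (α : F ⟶ G) (β : G ⟶ F)
    (h₁ : ∀ A, (Hom.natTrans α).app A ≫ (Hom.natTrans β).app A = 𝟙 _)
    (h₂ : ∀ A, (Hom.natTrans β).app A ≫ (Hom.natTrans α).app A = 𝟙 _) : F ≅ G where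
  hom := α
  inv := β
  hom_inv_id := hom_ext h₁
  inv_hom_id := hom_ext h₂

/-- The associator of composition. -/
def assocHom (F G H : StrongEndofunctor E) : ((F.comp G).comp H) ⟶ (F.comp (G.comp H)) where
  natTrans :=
    { app := fun A => 𝟙 (F.functor.obj (G.functor.obj (H.functor.obj A)))
      naturality := fun _ _ _ => (Category.comp_id _).trans (Category.id_comp _).symm }
  strong A B := by
    change prod.map (𝟙 A) (𝟙 (F.functor.obj (G.functor.obj (H.functor.obj B)))) ≫ F.strength A (G.functor.obj (H.functor.obj B)) ≫
            F.functor.map (G.strength A (H.functor.obj B) ≫ G.functor.map (H.strength A B)) =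
      ((F.strength A (G.functor.obj (H.functor.obj B)) ≫ F.functor.map (G.strength A (H.functor.obj B))) ≫
            F.functor.map (G.functor.map (H.strength A B))) ≫ 𝟙 (F.functor.obj (G.functor.obj (H.functor.obj (A ⨯ B))))
    simp

/-- The inverse associator of composition. -/
def assocInv (F G H : StrongEndofunctor E) : (F.comp (G.comp H)) ⟶ ((F.comp G).comp H) where
  natTrans :=
    { app := fun A => 𝟙 (F.functor.obj (G.functor.obj (H.functor.obj A)))
      naturality := fun _ _ _ => (Category.comp_id _).trans (Category.id_comp _).symm }
  strong A B := by
    change prod.map (𝟙 A) (𝟙 (F.functor.obj (G.functor.obj (H.functor.obj B)))) ≫ (F.strength A (G.functor.obj (H.functor.obj B)) ≫ F.functor.map (G.strength A (H.functor.obj B))) ≫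
            F.functor.map (G.functor.map (H.strength A B)) =
      (F.strength A (G.functor.obj (H.functor.obj B)) ≫
            F.functor.map (G.strength A (H.functor.obj B) ≫ G.functor.map (H.strength A B))) ≫ 𝟙 (F.functor.obj (G.functor.obj (H.functor.obj (A ⨯ B))))
    simp

/-- The left unitor of composition. -/
def leftUnitHom (F : StrongEndofunctor E) : unit.comp F ⟶ F where
  natTrans :=
    { app := fun A => 𝟙 (F.functor.obj A)
      naturality := fun _ _ _ => (Category.comp_id _).trans (Category.id_comp _).symm }
  strong A B := by
    change prod.map (𝟙 A) (𝟙 (F.functor.obj B)) ≫ F.strength A B =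
      (𝟙 (A ⨯ F.functor.obj B) ≫ F.strength A B) ≫ 𝟙 (F.functor.obj (A ⨯ B))
    simp

/-- The inverse left unitor of composition. -/
def leftUnitInv (F : StrongEndofunctor E) : F ⟶ unit.comp F where
  natTrans :=
    { app := fun A => 𝟙 (F.functor.obj A)
      naturality := fun _ _ _ => (Category.comp_id _).trans (Category.id_comp _).symm }
  strong A B := by
    change prod.map (𝟙 A) (𝟙 (F.functor.obj B)) ≫ 𝟙 (A ⨯ F.functor.obj B) ≫ F.strength A B =
      (F.strength A B) ≫ 𝟙 (F.functor.obj (A ⨯ B))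
    simp

/-- The right unitor of composition. -/
def rightUnitHom (F : StrongEndofunctor E) : F.comp unit ⟶ F where
  natTrans :=
    { app := fun A => 𝟙 (F.functor.obj A)
      naturality := fun _ _ _ => (Category.comp_id _).trans (Category.id_comp _).symm }
  strong A B := by
    change prod.map (𝟙 A) (𝟙 (F.functor.obj B)) ≫ F.strength A B =
      (F.strength A B ≫ F.functor.map (𝟙 (A ⨯ B))) ≫ 𝟙 (F.functor.obj (A ⨯ B))
    simp

/-- The inverse right unitor of composition. -/
def rightUnitInv (F : StrongEndofunctor E) : F ⟶ F.comp unit where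
  natTrans :=
    { app := fun A => 𝟙 (F.functor.obj A)
      naturality := fun _ _ _ => (Category.comp_id _).trans (Category.id_comp _).symm }
  strong A B := by
    change prod.map (𝟙 A) (𝟙 (F.functor.obj B)) ≫ F.strength A B ≫ F.functor.map (𝟙 (A ⨯ B)) =
      (F.strength A B) ≫ 𝟙 (F.functor.obj (A ⨯ B))
    simp

/-- Strong endofunctors form a monoidal category under composition, the product of `F` and `G`
being `A ↦ F (G A)`. -/
instance : MonoidalCategory (StrongEndofunctor E) where
  tensorObj F G := F.comp G
  tensorUnit := unit
  whiskerLeft F {G G'} β :=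
    { natTrans := Functor.whiskerRight (Hom.natTrans β) F.functor
      strong := fun A B => by
        have h1 := F.strength_natural (𝟙 A) ((Hom.natTrans β).app B)
        have h2 := congrArg F.functor.map (Hom.strong β A B)
        rw [Functor.map_comp, Functor.map_comp] at h2
        change prod.map (𝟙 A) (F.functor.map ((Hom.natTrans β).app B)) ≫
            F.strength A (G'.functor.obj B) ≫ F.functor.map (G'.strength A B) =
          (F.strength A (G.functor.obj B) ≫ F.functor.map (G.strength A B)) ≫
            F.functor.map ((Hom.natTrans β).app (A ⨯ B))
        rw [← Category.assoc, h1, Category.assoc, h2, Category.assoc] }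
  whiskerRight {F F'} α G :=
    { natTrans := Functor.whiskerLeft G.functor (Hom.natTrans α)
      strong := fun A B => by
        have h1 := Hom.strong α A (G.functor.obj B)
        have h2 := (Hom.natTrans α).naturality (G.strength A B)
        change prod.map (𝟙 A) ((Hom.natTrans α).app (G.functor.obj B)) ≫
            F'.strength A (G.functor.obj B) ≫ F'.functor.map (G.strength A B) =
          (F.strength A (G.functor.obj B) ≫ F.functor.map (G.strength A B)) ≫
            (Hom.natTrans α).app (G.functor.obj (A ⨯ B))
        rw [← Category.assoc, h1, Category.assoc, Category.assoc, h2] }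
  associator F G H := isoOfApp (assocHom F G H) (assocInv F G H)
    (fun A => Category.comp_id _) (fun A => Category.comp_id _)
  leftUnitor F := isoOfApp (leftUnitHom F) (leftUnitInv F)
    (fun A => Category.comp_id _) (fun A => Category.comp_id _)
  rightUnitor F := isoOfApp (rightUnitHom F) (rightUnitInv F)
    (fun A => Category.comp_id _) (fun A => Category.comp_id _)
  tensorHom_def := by intros; rfl
  id_tensorHom_id F G := by
    ext A
    change 𝟙 _ ≫ F.functor.map (𝟙 _) = 𝟙 _
    rw [CategoryTheory.Functor.map_id, Category.comp_id]
  tensorHom_comp_tensorHom {X₁ Y₁ Z₁ X₂ Y₂ Z₂} α β γ δ := by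
    ext A
    change ((Hom.natTrans α).app (X₂.functor.obj A) ≫ Y₁.functor.map ((Hom.natTrans β).app A)) ≫
        (Hom.natTrans γ).app (Y₂.functor.obj A) ≫ Z₁.functor.map ((Hom.natTrans δ).app A) =
      ((Hom.natTrans α).app (X₂.functor.obj A) ≫ (Hom.natTrans γ).app (X₂.functor.obj A)) ≫
        Z₁.functor.map ((Hom.natTrans β).app A ≫ (Hom.natTrans δ).app A)
    simp
  whiskerLeft_id F G := by
    ext A
    exact F.functor.map_id _
  id_whiskerRight F G := by
    ext A
    rfl
  associator_naturality {F₁ F₂ F₃ G₁ G₂ G₃} α β γ := by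
    ext A
    change ((((Hom.natTrans α).app (F₂.functor.obj (F₃.functor.obj A)) ≫
          G₁.functor.map ((Hom.natTrans β).app (F₃.functor.obj A))) ≫
        G₁.functor.map (G₂.functor.map ((Hom.natTrans γ).app A))) ≫
          𝟙 (G₁.functor.obj (G₂.functor.obj (G₃.functor.obj A)))) =
      𝟙 (F₁.functor.obj (F₂.functor.obj (F₃.functor.obj A))) ≫
        ((Hom.natTrans α).app (F₂.functor.obj (F₃.functor.obj A)) ≫
        G₁.functor.map ((Hom.natTrans β).app (F₃.functor.obj A) ≫
          G₂.functor.map ((Hom.natTrans γ).app A)))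
    simp
  leftUnitor_naturality {F G} α := by
    ext A
    exact (Category.comp_id _).trans (Category.id_comp _).symm
  rightUnitor_naturality {F G} α := by
    ext A
    exact (Category.comp_id _).trans (Category.id_comp _).symm
  pentagon F G H K := by
    ext A
    change 𝟙 (F.functor.obj (G.functor.obj (H.functor.obj (K.functor.obj A)))) ≫
      𝟙 (F.functor.obj (G.functor.obj (H.functor.obj (K.functor.obj A)))) ≫
        F.functor.map (𝟙 (G.functor.obj (H.functor.obj (K.functor.obj A)))) = 𝟙 _ ≫ 𝟙 _
    simp
  triangle F G := by
    ext A
    change 𝟙 _ ≫ F.functor.map (𝟙 _) = 𝟙 (F.functor.obj (G.functor.obj A))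
    simp

end StrongEndofunctor

namespace Poly

lemma evAt_congr (p : Poly E) {A T : E} {x x' : T ⟶ p.functor.obj A} {d : T ⟶ p.total}
    (e : x = x') (h : x ≫ p.proj A = d ≫ p.hom) :
    p.evAt x d h = p.evAt x' d (by rw [← e, h]) := by
  subst e; rfl

/-- The polynomial endofunctor of `p` with its strength. -/
def strongFunctor (p : Poly E) : StrongEndofunctor E where
  functor := p.functor
  strength := p.strength
  strength_natural {A A' B B'} f g := by
    refine functor_hom_ext p _ _ ?_ fun S a d hx hy => ?_
    · simp only [Category.assoc, strength_proj, map_proj, prod.map_snd_assoc]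
    · have hp : (a ≫ prod.snd) ≫ p.proj B = d ≫ p.hom := by
        rw [← hy]; simp only [Category.assoc, strength_proj, map_proj]
      have h1 : (a ≫ p.strength A B) ≫ p.proj (A ⨯ B) = d ≫ p.hom := by
        rw [← hp]; simp only [Category.assoc, strength_proj]
      have h2 : ((a ≫ prod.snd) ≫ p.functor.map g) ≫ p.proj B' = d ≫ p.hom := by
        rw [← hp, Category.assoc, map_proj]
      have ex : a ≫ prod.map f (p.functor.map g) ≫ p.strength A' B' =
        (a ≫ prod.map f (p.functor.map g)) ≫ p.strength A' B' := by simp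
      have ey : a ≫ p.strength A B ≫ p.functor.map (prod.map f g) =
        (a ≫ p.strength A B) ≫ p.functor.map (prod.map f g) := by simp
      have e3 : (a ≫ prod.map f (p.functor.map g)) ≫ prod.snd =
        (a ≫ prod.snd) ≫ p.functor.map g := by simp
      rw [evAt_congr p ex hx, evAt_congr p ey hy, evAt_map p _ _ d h1,
        evAt_strength p _ d _ (by rw [e3, h2]), evAt_strength p a d h1 hp,
        evAt_congr p e3, evAt_map p g _ d hp]
      apply prod.hom_ext <;> simp
  strength_unit B := by
    refine functor_hom_ext p _ _ ?_ fun S a d hx hy => ?_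
    · rw [Category.assoc, map_proj, strength_proj]; rfl
    · have hp : (a ≫ prod.snd) ≫ p.proj B = d ≫ p.hom := hy
      have h1 : (a ≫ p.strength _ B) ≫ p.proj _ = d ≫ p.hom := by
        rw [← hp]; simp only [Category.assoc, strength_proj]
      have ex : a ≫ p.strength _ B ≫ p.functor.map (prod.leftUnitor B).hom =
        (a ≫ p.strength _ B) ≫ p.functor.map (prod.leftUnitor B).hom := by simp
      rw [evAt_congr p ex hx, evAt_map p _ _ d h1, evAt_strength p a d h1 hp]
      exact prod.lift_snd _ _
  strength_assoc A A' B := by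
    refine functor_hom_ext p _ _ ?_ fun S a d hx hy => ?_
    · simp only [Category.assoc, strength_proj, map_proj, prod.map_snd_assoc,
        prod.associator_hom, prod.lift_snd_assoc]
    · have hp : (a ≫ prod.snd) ≫ p.proj B = d ≫ p.hom := by
        rw [← hx]; simp only [Category.assoc, strength_proj, map_proj]
      have h1 : (a ≫ p.strength (A ⨯ A') B) ≫ p.proj _ = d ≫ p.hom := by
        rw [← hp]; simp only [Category.assoc, strength_proj]
      have ex : a ≫ p.strength (A ⨯ A') B ≫ p.functor.map (prod.associator A A' B).hom =
        (a ≫ p.strength (A ⨯ A') B) ≫ p.functor.map (prod.associator A A' B).hom := by simp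
      let b : S ⟶ A' ⨯ p.functor.obj B := prod.lift (a ≫ prod.fst ≫ prod.snd) (a ≫ prod.snd)
      let c : S ⟶ A ⨯ p.functor.obj (A' ⨯ B) :=
        prod.lift (a ≫ prod.fst ≫ prod.fst) (b ≫ p.strength A' B)
      have ey : a ≫ (prod.associator A A' (p.functor.obj B)).hom ≫
          prod.map (𝟙 A) (p.strength A' B) ≫ p.strength A (A' ⨯ B) =
          c ≫ p.strength A (A' ⨯ B) := by
        simp only [← Category.assoc]
        congr 1
        apply prod.hom_ext <;> simp [b, c, prod.comp_lift]
      have hb : b ≫ prod.snd = a ≫ prod.snd := prod.lift_snd _ _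
      have hc : c ≫ prod.snd = b ≫ p.strength A' B := prod.lift_snd _ _
      have h2 : (b ≫ prod.snd) ≫ p.proj B = d ≫ p.hom := by rw [hb, hp]
      have h3 : (b ≫ p.strength A' B) ≫ p.proj _ = d ≫ p.hom := by
        rw [Category.assoc, strength_proj, ← Category.assoc, h2]
      have h4 : (c ≫ prod.snd) ≫ p.proj _ = d ≫ p.hom := by rw [hc, h3]
      rw [evAt_congr p ex hx, evAt_congr p ey hy, evAt_map p _ _ d h1,
        evAt_strength p a d h1 hp, evAt_strength p c d _ h4, evAt_congr p hc,
        evAt_strength p b d h3 h2, evAt_congr p hb]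
      apply prod.hom_ext
      · simp [c]
      · apply prod.hom_ext <;> simp [b]

/-- The strong natural transformation of polynomial functors induced by a morphism. -/
def strongTrans {p q : Poly E} (φ : p ⟶ q) : p.strongFunctor ⟶ q.strongFunctor where
  natTrans := trans φ
  strong A B := by
    change prod.map (𝟙 A) ((trans φ).app B) ≫ q.strength A B =
      p.strength A B ≫ (trans φ).app (A ⨯ B)
    refine functor_hom_ext q _ _ ?_ fun S a d hx hy => ?_
    · rw [Category.assoc, Category.assoc, trans_proj, strength_proj, ← Category.assoc,
        ← Category.assoc, strength_proj, prod.map_snd, Category.assoc, trans_proj,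
        Category.assoc]
    · let x := a ≫ (prod.snd : A ⨯ p.functor.obj B ⟶ _)
      have h0 : (x ≫ p.proj B) ≫ Hom.onBase φ = d ≫ q.hom := by
        rw [← hy]; simp only [x, Category.assoc, trans_proj]
        rw [← Category.assoc (p.strength A B), strength_proj, Category.assoc]
      have h1 : (x ≫ (trans φ).app B) ≫ q.proj B = d ≫ q.hom := by
        rw [← h0]; simp only [Category.assoc, trans_proj]
      have h2 : (a ≫ p.strength A B) ≫ p.proj _ = x ≫ p.proj B := by
        simp only [x, Category.assoc, strength_proj]
      have e3 : (a ≫ prod.map (𝟙 A) ((trans φ).app B)) ≫ prod.snd = x ≫ (trans φ).app B := by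
        simp [x]
      have ex : a ≫ prod.map (𝟙 A) ((trans φ).app B) ≫ q.strength A B =
        (a ≫ prod.map (𝟙 A) ((trans φ).app B)) ≫ q.strength A B := by simp
      have ey : a ≫ p.strength A B ≫ (trans φ).app (A ⨯ B) =
        (a ≫ p.strength A B) ≫ (trans φ).app (A ⨯ B) := by simp
      have h3 : ((a ≫ p.strength A B) ≫ p.proj _) ≫ Hom.onBase φ = d ≫ q.hom := by
        rw [h2, h0]
      rw [evAt_congr q ex hx, evAt_congr q ey hy, evAt_strength q _ d _ (by rw [e3, h1]),
        evAt_congr q e3, evAt_trans φ x d h1 h0, evAt_trans φ _ d _ h3,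
        evAt_strength p a _ (by rw [Hom.app_hom]) (by rw [Hom.app_hom, h2])]
      apply prod.hom_ext
      · simp
      · simp only [prod.lift_snd]
        congr 1
        simp only [h2]

end Poly

variable (E) in
/-- The functor `P` from polynomials to strong endofunctors. -/
def polyFunctor : Poly E ⥤ StrongEndofunctor E where
  obj p := p.strongFunctor
  map φ := Poly.strongTrans φ
  map_id p := StrongEndofunctor.Hom.ext (Poly.trans_id p)
  map_comp φ ψ := StrongEndofunctor.Hom.ext (Poly.trans_comp φ ψ)

/-- The component `A ⟶ P(y)(A)` of the unit comparison. -/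
def unitComparison (A : E) : A ⟶ (Poly.y E).functor.obj A :=
  (Poly.y E).lift (terminal.from A) (pullback.fst _ _)

/-- The component `p(q(A)) ⟶ (p ◁ q)(A)` of the multiplication comparison: an element of `p(q(A))`
is sent to the element with position its image in `p(Q)`, whose value at a pair of compatible
directions of `p` and of `q` is obtained by evaluating at the first and then at the second. -/
def mulComparison (p q : Poly E) (A : E) :
    p.functor.obj (q.functor.obj A) ⟶ (p.tri q).functor.obj A :=
  have c₁ : pullback.fst (p.functor.map (q.proj A)) (p.tri q).hom ≫ p.proj (q.functor.obj A) =
      (pullback.snd (p.functor.map (q.proj A)) (p.tri q).hom ≫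
        (pullback.fst (p.ev q.base) q.hom ≫ pullback.snd (p.proj q.base) p.hom :
          (p.tri q).total ⟶ p.total)) ≫ p.hom := by
    have h := pullback.condition (f := p.functor.map (q.proj A)) (g := (p.tri q).hom)
    have h' := congrArg (fun k => k ≫ p.proj q.base) h
    refine Eq.trans ?_ (h'.trans ?_)
    · rw [Category.assoc, Poly.map_proj]
    · have key {T : E} (s : T ⟶ pullback (p.ev q.base) q.hom) :
          (s ≫ pullback.fst (p.ev q.base) q.hom ≫ pullback.fst (p.proj q.base) p.hom) ≫
            p.proj q.base =
          (s ≫ pullback.fst (p.ev q.base) q.hom ≫ pullback.snd (p.proj q.base) p.hom) ≫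
            p.hom := by
        simp only [Category.assoc, pullback.condition]
      exact key _
  have c₂ : p.evAt (pullback.fst (p.functor.map (q.proj A)) (p.tri q).hom)
      (pullback.snd (p.functor.map (q.proj A)) (p.tri q).hom ≫
        (pullback.fst (p.ev q.base) q.hom ≫ pullback.snd (p.proj q.base) p.hom :
          (p.tri q).total ⟶ p.total)) c₁ ≫ q.proj A =
      (pullback.snd (p.functor.map (q.proj A)) (p.tri q).hom ≫
        (pullback.snd (p.ev q.base) q.hom : (p.tri q).total ⟶ q.total)) ≫ q.hom := by
    have h := pullback.condition (f := p.functor.map (q.proj A)) (g := (p.tri q).hom)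
    have h' : (pullback.fst (p.functor.map (q.proj A)) (p.tri q).hom ≫
        p.functor.map (q.proj A)) ≫ p.proj q.base =
      (pullback.snd (p.functor.map (q.proj A)) (p.tri q).hom ≫
        (pullback.fst (p.ev q.base) q.hom ≫ pullback.snd (p.proj q.base) p.hom :
          (p.tri q).total ⟶ p.total)) ≫ p.hom := by
      rw [Category.assoc, Poly.map_proj, c₁]
    rw [← Poly.evAt_map p (q.proj A) _ _ c₁ h', Poly.evAt_congr p h, Poly.evAt_eq_lift_ev]
    have key {T : E} (s : T ⟶ pullback (p.ev q.base) q.hom) (c) :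
        pullback.lift (s ≫ pullback.fst (p.ev q.base) q.hom ≫
          pullback.fst (p.proj q.base) p.hom) (s ≫ pullback.fst (p.ev q.base) q.hom ≫
          pullback.snd (p.proj q.base) p.hom) c ≫ p.ev q.base =
        (s ≫ pullback.snd (p.ev q.base) q.hom) ≫ q.hom := by
      have e : (s ≫ pullback.snd (p.ev q.base) q.hom) ≫ q.hom =
          (s ≫ pullback.fst (p.ev q.base) q.hom) ≫ p.ev q.base := by
        simp only [Category.assoc, pullback.condition]
      rw [e]
      congr 1
      apply pullback.hom_ext <;> simp
    exact key _ _
  (p.tri q).lift (p.functor.map (q.proj A)) (q.evAt _ _ c₂)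

variable (E) in
/-- The data of a monoidal structure on the category of polynomials whose product is `◁` on objects
and whose unit is `y`. -/
structure TriStruct where
  /-- The functors `p ◁ -` on morphisms. -/
  whiskerLeft (p : Poly E) {q q' : Poly E} (ψ : q ⟶ q') : p.tri q ⟶ p.tri q'
  /-- The functors `- ◁ q` on morphisms. -/
  whiskerRight {p p' : Poly E} (φ : p ⟶ p') (q : Poly E) : p.tri q ⟶ p'.tri q
  /-- The functor `◁` on morphisms. -/
  tensorHom {p p' q q' : Poly E} (φ : p ⟶ p') (ψ : q ⟶ q') : p.tri q ⟶ p'.tri q'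
  /-- The associators. -/
  associator (p q r : Poly E) : (p.tri q).tri r ≅ p.tri (q.tri r)
  /-- The left unitors. -/
  leftUnitor (p : Poly E) : (Poly.y E).tri p ≅ p
  /-- The right unitors. -/
  rightUnitor (p : Poly E) : p.tri (Poly.y E) ≅ p

/-- The same data, in the form used by the notion of a monoidal category. -/
@[reducible]
def TriStruct.toStruct (S : TriStruct E) : MonoidalCategoryStruct (Poly E) where
  tensorObj := Poly.tri
  tensorUnit := Poly.y E
  whiskerLeft := S.whiskerLeft
  whiskerRight := S.whiskerRight
  tensorHom := S.tensorHom
  associator := S.associator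
  leftUnitor := S.leftUnitor
  rightUnitor := S.rightUnitor

variable (E) in
/-- A structure of monoidal category on the category of polynomials whose product is `◁` on objects
and whose unit is `y`. -/
structure TriMonoidal extends TriStruct E where
  /-- The axioms of a monoidal category hold. -/
  isMonoidal : ∃ M : MonoidalCategory (Poly E),
    M.toMonoidalCategoryStruct = toTriStruct.toStruct

/-- The monoidal category of polynomials given by a structure as above. -/
@[reducible]
def TriMonoidal.monoidalCategory (S : TriMonoidal E) : MonoidalCategory (Poly E) :=
  { S.toTriStruct.toStruct with
    tensorHom_def := by
      obtain ⟨M, hM⟩ := S.isMonoidal; rw [← hM]; exact M.tensorHom_def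
    id_tensorHom_id := by
      obtain ⟨M, hM⟩ := S.isMonoidal; rw [← hM]; exact M.id_tensorHom_id
    tensorHom_comp_tensorHom := by
      obtain ⟨M, hM⟩ := S.isMonoidal; rw [← hM]; exact M.tensorHom_comp_tensorHom
    whiskerLeft_id := by
      obtain ⟨M, hM⟩ := S.isMonoidal; rw [← hM]; exact M.whiskerLeft_id
    id_whiskerRight := by
      obtain ⟨M, hM⟩ := S.isMonoidal; rw [← hM]; exact M.id_whiskerRight
    associator_naturality := by
      obtain ⟨M, hM⟩ := S.isMonoidal; rw [← hM]; exact M.associator_naturality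
    leftUnitor_naturality := by
      obtain ⟨M, hM⟩ := S.isMonoidal; rw [← hM]; exact M.leftUnitor_naturality
    rightUnitor_naturality := by
      obtain ⟨M, hM⟩ := S.isMonoidal; rw [← hM]; exact M.rightUnitor_naturality
    pentagon := by
      obtain ⟨M, hM⟩ := S.isMonoidal; rw [← hM]; exact M.pentagon
    triangle := by
      obtain ⟨M, hM⟩ := S.isMonoidal; rw [← hM]; exact M.triangle }

end CatPoly

end

noncomputable section

namespace CatPoly

variable {E : Type u} [Category.{v} E] [HasFiniteLimits E]

/-! ### Generalized elements of polynomial functors, and faithfulness. -/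

namespace Poly

attribute [local simp] pullback.lift_fst pullback.lift_snd pullback.lift_fst_assoc
  pullback.lift_snd_assoc prod.lift_fst prod.lift_snd prod.lift_fst_assoc prod.lift_snd_assoc

/-! A generalized element `T ⟶ p(A)` is a position `i : T ⟶ P` together with values `T ×_P P_* ⟶ A`.
It is determined by its position and by its evaluations at all generalized directions
(`functor_hom_ext`), so every equation below is checked on positions and on values.

Faithfulness is a Yoneda argument. The element `generic` of `p(P_*)`, defined over `P`, has as value
at each direction that direction itself. Applying `P(φ)` to it returns `φ₁` as position and `φ^♯` as
values, so `P(φ)` determines `φ`.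

For fullness, let `θ` be strong and let `φ₁` and `φ^♯` be read off from `θ` applied to `generic`.
Naturality along `A ⟶ 1` shows that the position of `θ(x)` depends only on the position of `x`. It
remains to see that `φ^♯` lies over `P` and that `θ` is determined by it, and this is where strength
enters. For `i : T ⟶ P` every element with position `i` is the image, under its own values, of the
universal element `lift i (𝟙 _)` of `p(T ×_P P_*)`. Inside `p(T × P_*)` this universal element is
the strength applied to `(𝟙 T, i ≫ generic)`. Hence the values of its image under `θ` are pairs
whose `T`-component is the identity (`evAt_lift_id_comp`): they are sections of `T ×_P P_* ⟶ T`.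
Without strength the values could move to another point of `T`.

For the monoidal part, an element of `p(q(A))` and an element of `(p ◁ q)(A)` both amount to a
position in `p(Q)` and a value for each compatible pair of directions, so the comparison is
invertible; it is also natural and strong, and the same holds for the unit. As `P` is fully
faithful, composition of strong endofunctors can be transported along these isomorphisms.
Conversely, naturality, associativity and unitality of the comparisons force the image under `P` of
every structure morphism, which gives uniqueness. -/

lemma evAt_congr₂ (p : Poly E) {A T : E} {x x' : T ⟶ p.functor.obj A} {d d' : T ⟶ p.total}
    (e : x = x') (e' : d = d') (h : x ≫ p.proj A = d ≫ p.hom) :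
    p.evAt x d h = p.evAt x' d' (by rw [← e, ← e', h]) := by
  subst e e'; rfl

/-- The generalized element of `p(A)` with position `f` and values `g` evaluates as expected. -/
lemma evAt_comp_lift (p : Poly E) {A T S : E} (f : T ⟶ p.base) (g : pullback f p.hom ⟶ A)
    (a : S ⟶ T) (d : S ⟶ p.total) (h' : a ≫ f = d ≫ p.hom) :
    p.evAt (a ≫ p.lift f g) d (by rw [Category.assoc, lift_proj, h']) =
      pullback.lift a d h' ≫ g :=
  evAt_lift p f g a d _

/-- A generalized element of `p(A)` is determined by its position and its values. -/
lemma lift_evAt (p : Poly E) {A T : E} (x : T ⟶ p.functor.obj A) :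
    p.lift (x ≫ p.proj A) (p.evAt (pullback.fst _ _ ≫ x) (pullback.snd _ _)
      (by rw [Category.assoc, pullback.condition])) = x := by
  refine p.functor_hom_ext _ _ (lift_proj _ _ _) fun S a d hx hy => ?_
  rw [evAt_lift, comp_evAt]
  exact evAt_congr₂ p (by simp) (by simp) _

/-- Functoriality acts by postcomposition on values. With `g = 𝟙` this exhibits every element as the
image of a universal one with the same position. -/
lemma lift_map (p : Poly E) {A B T : E} (f : T ⟶ p.base) (g : pullback f p.hom ⟶ A)
    (k : A ⟶ B) : p.lift f g ≫ p.functor.map k = p.lift f (g ≫ k) := by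
  refine p.functor_hom_ext _ _ (by rw [Category.assoc, map_proj, lift_proj, lift_proj])
    fun S a d hx hy => ?_
  have h1 : (a ≫ p.lift f g) ≫ p.proj A = d ≫ p.hom := by
    rw [← hy]; simp only [Category.assoc, lift_proj]
  rw [evAt_congr p (Category.assoc _ _ _).symm hx, evAt_map p k _ d h1, evAt_lift, evAt_lift,
    Category.assoc]

/-- The generalized element of `p(P_*)` defined on the positions whose value at a direction is
that direction. -/
def generic (p : Poly E) : p.base ⟶ p.functor.obj p.total :=
  p.lift (𝟙 p.base) (pullback.snd _ _)

lemma generic_proj (p : Poly E) : p.generic ≫ p.proj p.total = 𝟙 p.base :=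
  lift_proj _ _ _

lemma evAt_generic (p : Poly E) {T : E} (i : T ⟶ p.base) (d : T ⟶ p.total)
    (h : (i ≫ p.generic) ≫ p.proj p.total = d ≫ p.hom) : p.evAt (i ≫ p.generic) d h = d :=
  (evAt_lift _ _ _ _ _ _).trans (pullback.lift_snd _ _ _)

/-- The image of `generic` recovers both components: its position is `φ₁` and its values are `φ^♯`.
-/
lemma trans_injective {p q : Poly E} {φ ψ : p ⟶ q} (h : trans φ = trans ψ) : φ = ψ := by
  have hb : Hom.onBase φ = Hom.onBase ψ := by
    have e (χ : p ⟶ q) :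
        Hom.onBase χ = p.generic ≫ (trans χ).app p.total ≫ q.proj p.total := by
      rw [trans_proj, ← Category.assoc, generic_proj, Category.id_comp]
    rw [e φ, e ψ, h]
  refine Hom.ext_app hb fun T x d h₁ h₂ => ?_
  -- Pulled back along `x`, the generic element evaluates at `χ^♯(x, d)` to that same direction.
  have e (χ : p ⟶ q) (h : x ≫ Hom.onBase χ = d ≫ q.hom) :
      q.evAt ((x ≫ p.generic) ≫ (trans χ).app p.total) d
        (by rw [Category.assoc, trans_proj, Category.assoc, ← Category.assoc p.generic,
              generic_proj, Category.id_comp, h]) = Hom.app χ x d h := by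
    have hx : (x ≫ p.generic) ≫ p.proj p.total = x := by
      rw [Category.assoc, generic_proj, Category.comp_id]
    rw [evAt_trans χ _ d _ (by rw [hx, h]), evAt_generic]
    congr 1
  rw [← e φ h₁, ← e ψ h₂]
  congr 2
  rw [h]

/-! ### Fullness: recovering a morphism of polynomials from a strong transformation. -/

section Full

variable {p q : Poly E} (θ : p.functor ⟶ q.functor)

/-- Positions are unchanged by functor maps, so by naturality both sides can be computed after
mapping to `⊤_ E`. There an element carries no information beyond its position. -/
lemma comp_app_proj_eq {T A B : E} (x : T ⟶ p.functor.obj A) (x' : T ⟶ p.functor.obj B)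
    (h : x ≫ p.proj A = x' ≫ p.proj B) :
    (x ≫ θ.app A) ≫ q.proj A = (x' ≫ θ.app B) ≫ q.proj B := by
  have e {C : E} (z : T ⟶ p.functor.obj C) : (z ≫ θ.app C) ≫ q.proj C =
      (z ≫ p.functor.map (terminal.from C)) ≫ θ.app (⊤_ E) ≫ q.proj (⊤_ E) := by
    rw [Category.assoc, ← map_proj q (terminal.from C), ← NatTrans.naturality_assoc,
      Category.assoc]
  rw [e x, e x']
  congr 1
  refine p.functor_hom_ext _ _ ?_ fun S a d hx hy => terminal.hom_ext _ _
  rw [Category.assoc, map_proj, h, Category.assoc, map_proj]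

/-- The generalized element with position `i` whose value at a direction is that direction,
paired with the element of `T`, is obtained from the strength. -/
lemma lift_id_map (p : Poly E) {T : E} (i : T ⟶ p.base) :
    p.lift i (𝟙 _) ≫ p.functor.map (prod.lift (pullback.fst i p.hom) (pullback.snd i p.hom)) =
      prod.lift (𝟙 T) (i ≫ p.generic) ≫ p.strength T p.total := by
  rw [lift_map, Category.id_comp]
  refine p.functor_hom_ext _ _ ?_ fun S a d hx hy => ?_
  · rw [lift_proj, Category.assoc, strength_proj, prod.lift_snd_assoc, Category.assoc,
      generic_proj, Category.comp_id]
  · have e : (a ≫ prod.lift (𝟙 T) (i ≫ p.generic)) ≫ prod.snd = (a ≫ i) ≫ p.generic := by simp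
    have h1 : ((a ≫ i) ≫ p.generic) ≫ p.proj p.total = d ≫ p.hom := by
      rw [← hx, Category.assoc, Category.assoc, Category.assoc, lift_proj, generic_proj,
        Category.comp_id]
    rw [evAt_lift, evAt_congr p (Category.assoc _ _ _).symm hy,
      evAt_strength p _ d _ (by rw [e, h1]), evAt_congr p e, evAt_generic]
    apply prod.hom_ext <;> simp

/-- The heart of fullness: a value of `θ` at the universal element is a section of `T ×_P P_* ⟶ T`.
The embedding of `T ×_P P_*` into `T ⨯ p.total` turns the universal element into one produced by the
strength. Since `θ` commutes with the strength, the `T`-component passes through `θ` unchanged. -/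
lemma evAt_lift_id_comp
    (hθ : ∀ A B, prod.map (𝟙 A) (θ.app B) ≫ q.strength A B = p.strength A B ≫ θ.app (A ⨯ B))
    {T : E} (i : T ⟶ p.base) (d : T ⟶ q.total)
    (h : (p.lift i (𝟙 _) ≫ θ.app _) ≫ q.proj _ = d ≫ q.hom)
    (h' : ((i ≫ p.generic) ≫ θ.app _) ≫ q.proj _ = d ≫ q.hom) :
    q.evAt (p.lift i (𝟙 _) ≫ θ.app _) d h ≫ pullback.fst i p.hom = 𝟙 T ∧
      q.evAt (p.lift i (𝟙 _) ≫ θ.app _) d h ≫ pullback.snd i p.hom =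
        q.evAt ((i ≫ p.generic) ≫ θ.app _) d h' := by
  -- Naturality of `θ` at the embedding, then `lift_id_map`, then strongness.
  have e : (p.lift i (𝟙 _) ≫ θ.app _) ≫
      q.functor.map (prod.lift (pullback.fst i p.hom) (pullback.snd i p.hom)) =
      prod.lift (𝟙 T) ((i ≫ p.generic) ≫ θ.app _) ≫ q.strength T p.total := by
    rw [Category.assoc, ← θ.naturality, ← Category.assoc, lift_id_map, Category.assoc, ← hθ,
      ← Category.assoc, prod.lift_map, Category.comp_id]
  have h1 : ((p.lift i (𝟙 _) ≫ θ.app _) ≫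
      q.functor.map (prod.lift (pullback.fst i p.hom) (pullback.snd i p.hom))) ≫ q.proj _ =
      d ≫ q.hom := by
    rw [Category.assoc, map_proj, h]
  have e2 : q.evAt (p.lift i (𝟙 _) ≫ θ.app _) d h ≫
      prod.lift (pullback.fst i p.hom) (pullback.snd i p.hom) =
      prod.lift (𝟙 T) (q.evAt ((i ≫ p.generic) ≫ θ.app _) d h') := by
    rw [← evAt_map q _ _ d h h1, evAt_congr q e h1,
      evAt_strength q _ d _ (by rw [prod.lift_snd, h']), evAt_congr q (prod.lift_snd _ _),
      prod.lift_fst]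
  rw [prod.comp_lift] at e2
  exact ⟨by simpa using congrArg (fun k => k ≫ prod.fst) e2,
    (prod.lift_snd _ _).symm.trans ((congrArg (fun k => k ≫ prod.snd) e2).trans
      (prod.lift_snd _ _))⟩

/-- This value is the second component of a section of `pullback.fst i p.hom`, so the pullback
square places it over `i`. -/
lemma evAt_generic_comp_hom
    (hθ : ∀ A B, prod.map (𝟙 A) (θ.app B) ≫ q.strength A B = p.strength A B ≫ θ.app (A ⨯ B))
    {T : E} (i : T ⟶ p.base) (d : T ⟶ q.total)
    (h' : ((i ≫ p.generic) ≫ θ.app _) ≫ q.proj _ = d ≫ q.hom) :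
    q.evAt ((i ≫ p.generic) ≫ θ.app _) d h' ≫ p.hom = i := by
  have h : (p.lift i (𝟙 _) ≫ θ.app _) ≫ q.proj _ = d ≫ q.hom := by
    rw [← h']
    apply comp_app_proj_eq
    rw [lift_proj, Category.assoc, generic_proj, Category.comp_id]
  obtain ⟨e1, e2⟩ := evAt_lift_id_comp θ hθ i d h h'
  rw [← e2, Category.assoc, ← pullback.condition, ← Category.assoc, e1, Category.id_comp]

/-- The morphism of polynomials inducing a given strong natural transformation. -/
def homOfStrong
    (hθ : ∀ A B, prod.map (𝟙 A) (θ.app B) ≫ q.strength A B = p.strength A B ≫ θ.app (A ⨯ B)) :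
    Hom p q where
  onBase := (p.generic ≫ θ.app p.total) ≫ q.proj p.total
  onTotal := q.evAt ((pullback.fst _ _ ≫ p.generic) ≫ θ.app p.total) (pullback.snd _ _)
    (by rw [← pullback.condition]; simp only [Category.assoc])
  onTotal_hom := evAt_generic_comp_hom θ hθ _ _ _

/-- The defining formula for `onTotal` is stable under base change, because evaluation is; it thus
holds at every stage and not only at the universal pullback. -/
lemma homOfStrong_app
    (hθ : ∀ A B, prod.map (𝟙 A) (θ.app B) ≫ q.strength A B = p.strength A B ≫ θ.app (A ⨯ B))
    {T : E} (i : T ⟶ p.base) (d : T ⟶ q.total)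
    (h : i ≫ (homOfStrong θ hθ).onBase = d ≫ q.hom)
    (h' : ((i ≫ p.generic) ≫ θ.app _) ≫ q.proj _ = d ≫ q.hom) :
    (homOfStrong θ hθ).app i d h = q.evAt ((i ≫ p.generic) ≫ θ.app p.total) d h' := by
  refine (comp_evAt _ _ _ _ _).trans (evAt_congr₂ q ?_ (pullback.lift_snd _ _ _) _)
  have e : pullback.lift i d h ≫ pullback.fst _ _ = i := pullback.lift_fst _ _ _
  refine Eq.trans ?_ (congrArg (fun k => (k ≫ p.generic) ≫ θ.app p.total) e)
  simp only [Category.assoc]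
  rfl

/-- An arbitrary element is the image of the universal element at its position under its own values.
Naturality therefore reduces `θ` to the universal element, where its values are known to be the
section given by `φ^♯`. -/
lemma trans_homOfStrong
    (hθ : ∀ A B, prod.map (𝟙 A) (θ.app B) ≫ q.strength A B = p.strength A B ≫ θ.app (A ⨯ B)) :
    trans (p := p) (q := q) (homOfStrong θ hθ) = θ := by
  ext A
  -- `a` and the generic element pulled back to its position have the same position, so their images
  -- under `θ` do too.
  have hb {S : E} (a : S ⟶ p.functor.obj A) :
      (((a ≫ p.proj A) ≫ p.generic) ≫ θ.app _) ≫ q.proj _ = (a ≫ θ.app A) ≫ q.proj A := by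
    apply comp_app_proj_eq
    rw [Category.assoc, generic_proj, Category.comp_id]
  refine q.functor_hom_ext _ _ ?_ fun S a d hx hy => ?_
  · rw [trans_proj]
    have := hb (𝟙 _)
    rw [Category.id_comp, Category.id_comp] at this
    rw [← this]
    simp only [homOfStrong, Category.assoc]
  · have h' := (hb a).trans hy
    have h0 : (a ≫ p.proj A) ≫ (homOfStrong θ hθ).onBase = d ≫ q.hom := by
      rw [← h']; simp only [homOfStrong, Category.assoc]
    have h : (p.lift (a ≫ p.proj A) (𝟙 _) ≫ θ.app _) ≫ q.proj _ = d ≫ q.hom := by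
      rw [← hy]
      exact comp_app_proj_eq θ _ _ (lift_proj _ _ _)
    obtain ⟨e1, e2⟩ := evAt_lift_id_comp θ hθ (a ≫ p.proj A) d h h'
    -- Here `a` is rewritten as the functor applied to its values, evaluated on the universal
    -- element, and `θ` is moved past that map.
    have ea : a ≫ θ.app A = (p.lift (a ≫ p.proj A) (𝟙 _) ≫ θ.app _) ≫
        q.functor.map (p.evAt (pullback.fst _ _ ≫ a) (pullback.snd _ _)
          (by rw [Category.assoc, pullback.condition])) := by
      rw [Category.assoc, ← θ.naturality, ← Category.assoc, lift_map, Category.id_comp,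
        lift_evAt]
    rw [evAt_trans (p := p) (q := q) (homOfStrong θ hθ) a d hx h0, evAt_congr q ea hy,
      evAt_map q _ _ d h, comp_evAt]
    refine evAt_congr₂ p ?_ ?_ _
    · rw [← Category.assoc, e1, Category.id_comp]
    · rw [e2]
      exact homOfStrong_app θ hθ _ d h0 h'

end Full

end Poly

instance polyFunctor_faithful : (polyFunctor E).Faithful where
  map_injective h := Poly.trans_injective (congrArg StrongEndofunctor.Hom.natTrans h)

instance polyFunctor_full : (polyFunctor E).Full where
  map_surjective θ :=
    ⟨Poly.homOfStrong (StrongEndofunctor.Hom.natTrans θ) (StrongEndofunctor.Hom.strong θ),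
      StrongEndofunctor.Hom.ext (Poly.trans_homOfStrong _ _)⟩

/-! ### The multiplication comparison is an isomorphism. -/

namespace Poly

section Tri

variable (p q : Poly E)

/-- The direction of `p` underlying a direction of `p ◁ q`. -/
def triFst : (p.tri q).total ⟶ p.total :=
  pullback.fst (p.ev q.base) q.hom ≫ pullback.snd (p.proj q.base) p.hom

/-- The direction of `q` underlying a direction of `p ◁ q`. -/
def triSnd : (p.tri q).total ⟶ q.total :=
  pullback.snd (p.ev q.base) q.hom

variable {p q}

lemma comp_proj_eq_triFst {T : E} {y : T ⟶ p.functor.obj q.base} {d : T ⟶ (p.tri q).total}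
    (h : y = d ≫ (p.tri q).hom) : y ≫ p.proj q.base = (d ≫ triFst p q) ≫ p.hom := by
  -- Giving `d` the explicit pullback as codomain makes the pullback conditions hidden in `(p.tri
  -- q).total` available to rewriting.
  have key (d : T ⟶ pullback (p.ev q.base) q.hom) :
      (d ≫ pullback.fst (p.ev q.base) q.hom ≫ pullback.fst (p.proj q.base) p.hom) ≫
        p.proj q.base =
      (d ≫ pullback.fst (p.ev q.base) q.hom ≫ pullback.snd (p.proj q.base) p.hom) ≫ p.hom := by
    simp only [Category.assoc, pullback.condition]
  rw [h]
  exact key d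

/-- This is the compatibility of the two directions, namely the pullback square over `q.base` that
defines the directions of `p ◁ q`. -/
lemma evAt_triFst {T : E} {y : T ⟶ p.functor.obj q.base} {d : T ⟶ (p.tri q).total}
    (h : y = d ≫ (p.tri q).hom) :
    p.evAt y (d ≫ triFst p q) (comp_proj_eq_triFst h) = (d ≫ triSnd p q) ≫ q.hom := by
  rw [evAt_eq_lift_ev]
  have key (d : T ⟶ pullback (p.ev q.base) q.hom)
      (h : y = d ≫ pullback.fst (p.ev q.base) q.hom ≫ pullback.fst (p.proj q.base) p.hom) (c) :
      pullback.lift y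
          (d ≫ pullback.fst (p.ev q.base) q.hom ≫ pullback.snd (p.proj q.base) p.hom) c ≫
        p.ev q.base = (d ≫ pullback.snd (p.ev q.base) q.hom) ≫ q.hom := by
    have e : (d ≫ pullback.snd (p.ev q.base) q.hom) ≫ q.hom =
        (d ≫ pullback.fst (p.ev q.base) q.hom) ≫ p.ev q.base := by
      simp only [Category.assoc, pullback.condition]
    rw [e]
    congr 1
    apply pullback.hom_ext
    · rw [pullback.lift_fst, h, Category.assoc]
    · rw [pullback.lift_snd, Category.assoc]
  exact key d h _

/-- The direction of `p ◁ q` at `y` given by compatible directions of `p` and of `q`. -/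
def triLift {T : E} (y : T ⟶ p.functor.obj q.base) (d : T ⟶ p.total) (e : T ⟶ q.total)
    (h : y ≫ p.proj q.base = d ≫ p.hom) (h' : p.evAt y d h = e ≫ q.hom) :
    T ⟶ (p.tri q).total :=
  pullback.lift (pullback.lift y d h) e ((evAt_eq_lift_ev p y d h).symm.trans h')

lemma triLift_hom {T : E} (y : T ⟶ p.functor.obj q.base) (d : T ⟶ p.total) (e : T ⟶ q.total)
    (h : y ≫ p.proj q.base = d ≫ p.hom) (h' : p.evAt y d h = e ≫ q.hom) :
    triLift y d e h h' ≫ (p.tri q).hom = y :=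
  (pullback.lift_fst_assoc _ _ _ _).trans (pullback.lift_fst _ _ _)

lemma triLift_triFst {T : E} (y : T ⟶ p.functor.obj q.base) (d : T ⟶ p.total)
    (e : T ⟶ q.total) (h : y ≫ p.proj q.base = d ≫ p.hom) (h' : p.evAt y d h = e ≫ q.hom) :
    triLift y d e h h' ≫ triFst p q = d :=
  (pullback.lift_fst_assoc _ _ _ _).trans (pullback.lift_snd _ _ _)

lemma triLift_triSnd {T : E} (y : T ⟶ p.functor.obj q.base) (d : T ⟶ p.total)
    (e : T ⟶ q.total) (h : y ≫ p.proj q.base = d ≫ p.hom) (h' : p.evAt y d h = e ≫ q.hom) :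
    triLift y d e h h' ≫ triSnd p q = e :=
  pullback.lift_snd _ _ _

/-- The directions of `p ◁ q` form an iterated pullback, whose three projections are the position
and the two underlying directions. -/
lemma tri_total_hom_ext {T : E} {d d' : T ⟶ (p.tri q).total}
    (h : d ≫ (p.tri q).hom = d' ≫ (p.tri q).hom) (h₁ : d ≫ triFst p q = d' ≫ triFst p q)
    (h₂ : d ≫ triSnd p q = d' ≫ triSnd p q) : d = d' := by
  refine pullback.hom_ext (pullback.hom_ext ?_ ?_) h₂
  · exact (Category.assoc _ _ _).trans (h.trans (Category.assoc _ _ _).symm)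
  · exact (Category.assoc _ _ _).trans (h₁.trans (Category.assoc _ _ _).symm)

variable (p q)

lemma mulComparison_proj (A : E) :
    mulComparison p q A ≫ (p.tri q).proj A = p.functor.map (q.proj A) :=
  lift_proj _ _ _

variable {p q}

lemma comp_mulComparison_proj {A T : E} (x : T ⟶ p.functor.obj (q.functor.obj A)) :
    (x ≫ mulComparison p q A) ≫ (p.tri q).proj A = x ≫ p.functor.map (q.proj A) := by
  rw [Category.assoc, mulComparison_proj]; rfl

/-- A direction at the image of `x` can be used on `x` itself. This lemma allows the first
evaluation, in `p`, and the next one allows the second, in `q`. -/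
lemma comp_proj_eq_of_mulComparison {A T : E} {x : T ⟶ p.functor.obj (q.functor.obj A)}
    {d : T ⟶ (p.tri q).total}
    (h : (x ≫ mulComparison p q A) ≫ (p.tri q).proj A = d ≫ (p.tri q).hom) :
    x ≫ p.proj _ = (d ≫ triFst p q) ≫ p.hom := by
  rw [← comp_proj_eq_triFst ((comp_mulComparison_proj x).symm.trans h), Category.assoc, map_proj]

lemma evAt_comp_proj_eq_of_mulComparison {A T : E} {x : T ⟶ p.functor.obj (q.functor.obj A)}
    {d : T ⟶ (p.tri q).total}
    (h : (x ≫ mulComparison p q A) ≫ (p.tri q).proj A = d ≫ (p.tri q).hom) :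
    p.evAt x (d ≫ triFst p q) (comp_proj_eq_of_mulComparison h) ≫ q.proj A =
      (d ≫ triSnd p q) ≫ q.hom := by
  rw [← evAt_triFst ((comp_mulComparison_proj x).symm.trans h), evAt_map]

/-- The multiplication comparison evaluates at the direction of `p`, then at that of `q`. -/
lemma evAt_mulComparison {A T : E} (x : T ⟶ p.functor.obj (q.functor.obj A))
    (d : T ⟶ (p.tri q).total)
    (h : (x ≫ mulComparison p q A) ≫ (p.tri q).proj A = d ≫ (p.tri q).hom) :
    (p.tri q).evAt (x ≫ mulComparison p q A) d h =
      q.evAt (p.evAt x (d ≫ triFst p q) (comp_proj_eq_of_mulComparison h)) (d ≫ triSnd p q)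
        (evAt_comp_proj_eq_of_mulComparison h) := by
  -- The comparison is a `lift` whose values live on the pullback of this square; `l` is the point
  -- of it given by `x` and `d`.
  have hd : x ≫ p.functor.map (q.proj A) = d ≫ (p.tri q).hom :=
    (comp_mulComparison_proj x).symm.trans h
  let l : T ⟶ pullback (C := E) (p.functor.map (q.proj A)) (p.tri q).hom := pullback.lift x d hd
  have l₁ : l ≫ pullback.fst _ _ = x := pullback.lift_fst _ _ _
  have l₂ : l ≫ pullback.snd _ _ = d := pullback.lift_snd _ _ _
  refine (evAt_lift (p.tri q) _ _ x d h).trans ?_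
  refine (comp_evAt q l _ _ _).trans (evAt_congr₂ q ?_ ?_ _)
  · refine (comp_evAt p l _ _ _).trans (evAt_congr₂ p l₁ ?_ _)
    exact (Category.assoc _ _ _).symm.trans (congrArg (fun k => k ≫ triFst p q) l₂)
  · exact (Category.assoc _ _ _).symm.trans (congrArg (fun k => k ≫ triSnd p q) l₂)

/-- Generalized elements of `p(q(A))` with the same image under the comparison agree. -/
instance mono_mulComparison (A : E) : Mono (mulComparison p q A) where
  right_cancellation {T} x x' hxx := by
    have hpos : x ≫ p.functor.map (q.proj A) = x' ≫ p.functor.map (q.proj A) := by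
      rw [← comp_mulComparison_proj, hxx, comp_mulComparison_proj]
    have hproj : x ≫ p.proj _ = x' ≫ p.proj _ := by
      rw [← map_proj p (q.proj A), ← Category.assoc, hpos, Category.assoc]
    refine p.functor_hom_ext _ _ hproj fun S a d hx hx' => ?_
    have hm : (a ≫ x) ≫ p.functor.map (q.proj A) = (a ≫ x') ≫ p.functor.map (q.proj A) := by
      rw [Category.assoc, hpos, Category.assoc]
    have hy : ((a ≫ x) ≫ p.functor.map (q.proj A)) ≫ p.proj _ = d ≫ p.hom := by
      rw [Category.assoc, map_proj, hx]
    -- The values in `q(A)` are compared by extensionality once more, now for `q`. Their positions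
    -- agree because these are the values of the common position in `p(Q)`.
    refine q.functor_hom_ext _ _ ?_ fun R b e hz hz' => ?_
    · rw [← evAt_map p (q.proj A) _ d hx hy, ← evAt_map p (q.proj A) _ d hx' (by rw [← hm, hy])]
      exact evAt_congr p hm _
    · have hy' : (b ≫ (a ≫ x) ≫ p.functor.map (q.proj A)) ≫ p.proj _ = (b ≫ d) ≫ p.hom := by
        rw [Category.assoc, hy, Category.assoc]
      have he : p.evAt (b ≫ (a ≫ x) ≫ p.functor.map (q.proj A)) (b ≫ d) hy' = e ≫ q.hom := by
        rw [← comp_evAt p b _ _ hy, evAt_map p _ _ _ hx, ← Category.assoc, hz]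
      -- The pair of `d` and `e` is a single direction of `p ◁ q`. It is built from `x`, but serves
      -- `x'` as well since the two share a position in `p(Q)`; hence `ht` is stated for any such
      -- `z`.
      let t : R ⟶ (p.tri q).total := triLift _ _ _ hy' he
      have ht (z : T ⟶ p.functor.obj (q.functor.obj A))
          (hz0 : z ≫ p.functor.map (q.proj A) = x ≫ p.functor.map (q.proj A))
          (h1 : (a ≫ z) ≫ p.proj _ = d ≫ p.hom)
          (h2 : (b ≫ p.evAt (a ≫ z) d h1) ≫ q.proj A = e ≫ q.hom) :
          ∃ h, q.evAt (b ≫ p.evAt (a ≫ z) d h1) e h2 =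
            (p.tri q).evAt ((b ≫ a ≫ z) ≫ mulComparison p q A) t h := by
        refine ⟨?_, ?_⟩
        · rw [comp_mulComparison_proj]
          refine Eq.trans ?_ (triLift_hom _ _ _ hy' he).symm
          simp only [Category.assoc, hz0]
          rfl
        · rw [evAt_mulComparison]
          refine evAt_congr₂ q ?_ (triLift_triSnd _ _ _ _ _).symm _
          rw [comp_evAt]
          exact evAt_congr₂ p rfl (triLift_triFst _ _ _ _ _).symm _
      obtain ⟨k, hk⟩ := ht x rfl hx hz
      obtain ⟨k', hk'⟩ := ht x' hpos.symm hx' hz'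
      rw [hk, hk']
      exact evAt_congr _ (by simp only [Category.assoc, hxx]) _

/-- The element of `p(q(A))` determined by an element of `(p ◁ q)(A)`. -/
lemma exists_comp_mulComparison {A T : E} (z : T ⟶ (p.tri q).functor.obj A) :
    ∃ s : T ⟶ p.functor.obj (q.functor.obj A), s ≫ mulComparison p q A = z := by
  -- The position of `z`, recorded with codomain `p.functor.obj q.base` instead of the base of
  -- `p.tri q`.
  obtain ⟨y, hy⟩ : ∃ y : T ⟶ p.functor.obj q.base, y = z ≫ (p.tri q).proj A := ⟨_, rfl⟩
  -- The preimage is found by currying: `f` sends a direction of `p` to the position of `q` assigned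
  -- by `y`, and `g` sends a further direction of `q` to the value of `z` at the pair.
  let f : pullback (y ≫ p.proj _) p.hom ⟶ q.base :=
    p.evAt (pullback.fst _ _ ≫ y) (pullback.snd _ _) (by rw [Category.assoc, pullback.condition])
  have h₁ : (pullback.fst f q.hom ≫ pullback.fst (y ≫ p.proj _) p.hom ≫ y) ≫ p.proj _ =
      (pullback.fst f q.hom ≫ pullback.snd (y ≫ p.proj _) p.hom) ≫ p.hom := by
    simp only [Category.assoc, ← pullback.condition]
  have h₂ : p.evAt _ _ h₁ = pullback.snd f q.hom ≫ q.hom := by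
    rw [← pullback.condition]
    exact (comp_evAt _ _ _ _ _).symm
  let g : pullback f q.hom ⟶ A :=
    (p.tri q).evAt ((pullback.fst f q.hom ≫ pullback.fst _ _) ≫ z) (triLift _ _ _ h₁ h₂)
      ((Category.assoc _ _ _).trans
        ((congrArg (fun k => (pullback.fst f q.hom ≫ pullback.fst _ _) ≫ k) hy.symm).trans
          ((Category.assoc _ _ _).trans (triLift_hom _ _ _ h₁ h₂).symm)))
  let s : T ⟶ p.functor.obj (q.functor.obj A) := p.lift (y ≫ p.proj _) (q.lift f g)
  have hs : s ≫ p.functor.map (q.proj A) = y := by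
    rw [lift_map, lift_proj, lift_evAt]
  refine ⟨s, (p.tri q).functor_hom_ext _ _ ?_ fun S a d h h' => ?_⟩
  · rw [comp_mulComparison_proj, hs, hy]
  · have hd : a ≫ y = d ≫ (p.tri q).hom := by
      rw [hy, ← h']; exact (Category.assoc _ _ _).symm
    have h0 : ((a ≫ s) ≫ mulComparison p q A) ≫ (p.tri q).proj A = d ≫ (p.tri q).hom := by
      rw [← h]; simp only [Category.assoc]
    rw [evAt_congr _ (Category.assoc _ _ _).symm h, evAt_mulComparison _ _ h0]
    have hl : a ≫ y ≫ p.proj _ = (d ≫ triFst p q) ≫ p.hom := by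
      rw [← comp_proj_eq_triFst hd, Category.assoc]
    have e₁ : p.evAt (a ≫ s) (d ≫ triFst p q) (comp_proj_eq_of_mulComparison h0) =
        pullback.lift a (d ≫ triFst p q) hl ≫ q.lift f g := evAt_lift _ _ _ _ _ _
    -- The position of the inner element at the first direction is the one under the second
    -- direction, so the inner `lift` can be evaluated there.
    have hl' : pullback.lift a (d ≫ triFst p q) hl ≫ f = (d ≫ triSnd p q) ≫ q.hom := by
      rw [← evAt_triFst hd]
      refine (comp_evAt _ _ _ _ _).trans (evAt_congr₂ p ?_ (pullback.lift_snd _ _ _) _)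
      rw [← Category.assoc, pullback.lift_fst]
    rw [evAt_congr q e₁]
    refine (evAt_comp_lift q f g _ _ hl').trans ?_
    refine (comp_evAt _ _ _ _ _).trans (evAt_congr₂ _ ?_ ?_ _)
    · simp only [← Category.assoc, pullback.lift_fst]
    · refine tri_total_hom_ext ?_ ?_ ?_
      · rw [Category.assoc, triLift_hom, ← hd]
        exact (pullback.lift_fst_assoc _ _ _ _).trans (pullback.lift_fst_assoc _ _ _ _)
      · rw [Category.assoc, triLift_triFst, ← Category.assoc, pullback.lift_fst,
          pullback.lift_snd]
      · rw [Category.assoc, triLift_triSnd, pullback.lift_snd]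

/-- Lifting the identity gives a right inverse `s`, and a monomorphism with a right inverse is
invertible. -/
instance isIso_mulComparison (A : E) : IsIso (mulComparison p q A) := by
  obtain ⟨s, hs⟩ := exists_comp_mulComparison (p := p) (q := q) (𝟙 ((p.tri q).functor.obj A))
  exact ⟨s, by rw [← cancel_mono (mulComparison p q A), Category.assoc, hs]; simp, hs⟩

end Tri

end Poly

/-! ### Naturality and strength of the comparisons, and the unit. -/

namespace Poly

/-- Values are computed by two successive evaluations, and each evaluation commutes with functor
maps. -/
lemma mulComparison_naturality (p q : Poly E) {A B : E} (k : A ⟶ B) :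
    p.functor.map (q.functor.map k) ≫ mulComparison p q B =
      mulComparison p q A ≫ (p.tri q).functor.map k := by
  refine (p.tri q).functor_hom_ext _ _ ?_ fun S a d h h' => ?_
  · rw [Category.assoc, Category.assoc, map_proj, mulComparison_proj, mulComparison_proj]
    refine (p.functor.map_comp _ _).symm.trans ?_
    rw [map_proj]
  · have h1 : ((a ≫ p.functor.map (q.functor.map k)) ≫ mulComparison p q B) ≫
        (p.tri q).proj B = d ≫ (p.tri q).hom := by rw [← h]; simp only [Category.assoc]
    have h2 : (a ≫ mulComparison p q A) ≫ (p.tri q).proj A = d ≫ (p.tri q).hom := by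
      rw [← h']; simp only [Category.assoc, map_proj]
    have h3 : (p.evAt a (d ≫ triFst p q) (comp_proj_eq_of_mulComparison h2) ≫ q.functor.map k) ≫
        q.proj B = (d ≫ triSnd p q) ≫ q.hom := by
      rw [Category.assoc, map_proj, evAt_comp_proj_eq_of_mulComparison h2]
    rw [evAt_congr _ (Category.assoc _ _ _).symm h, evAt_congr _ (Category.assoc _ _ _).symm h',
      evAt_map _ k _ _ h2, evAt_mulComparison _ _ h1, evAt_mulComparison _ _ h2,
      evAt_congr q (evAt_map p _ _ _ (comp_proj_eq_of_mulComparison h2) _), evAt_map q _ _ _ _ h3]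

/-- Used to compare positions in `mulComparison_strength`: the position in `p(Q)` does not see the
adjoined element of `A`. -/
lemma strength_map_snd (p : Poly E) (A B : E) :
    p.strength A B ≫ p.functor.map prod.snd = prod.snd := by
  refine p.functor_hom_ext _ _ (by rw [Category.assoc, map_proj, strength_proj])
    fun S a d h h' => ?_
  have h1 : (a ≫ p.strength A B) ≫ p.proj _ = d ≫ p.hom := by
    rw [← h', Category.assoc, strength_proj, Category.assoc]
  rw [evAt_congr p (Category.assoc _ _ _).symm h, evAt_map p _ _ _ h1, evAt_strength p _ _ _ h',
    prod.lift_snd]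

/-- On either side the value at a pair of directions is the given element of `A` together with the
iterated value. For the composite strength, the element is adjoined first inside `p` and then inside
`q`. -/
lemma mulComparison_strength (p q : Poly E) (A B : E) :
    prod.map (𝟙 A) (mulComparison p q B) ≫ (p.tri q).strength A B =
      (p.strength A (q.functor.obj B) ≫ p.functor.map (q.strength A B)) ≫
        mulComparison p q (A ⨯ B) := by
  refine (p.tri q).functor_hom_ext _ _ ?_ fun S a d h h' => ?_
  · rw [Category.assoc, strength_proj, prod.map_snd_assoc, mulComparison_proj, Category.assoc,
      mulComparison_proj]
    refine Eq.trans ?_ (Category.assoc _ _ _).symm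
    refine Eq.trans ?_ (congrArg (fun k => p.strength A (q.functor.obj B) ≫ k)
      (p.functor.map_comp _ _))
    rw [strength_proj, p.functor.map_comp]
    exact (congrArg (fun k => k ≫ p.functor.map (q.proj B)) (strength_map_snd p _ _)).symm.trans
      (Category.assoc _ _ _)
  · let x := a ≫ (prod.snd : A ⨯ p.functor.obj (q.functor.obj B) ⟶ _)
    have h1 : (x ≫ mulComparison p q B) ≫ (p.tri q).proj B = d ≫ (p.tri q).hom := by
      rw [← h]; simp only [x, Category.assoc, strength_proj, prod.map_snd_assoc]
    have hx := comp_proj_eq_of_mulComparison h1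
    have h2 : ((a ≫ p.strength A (q.functor.obj B) ≫ p.functor.map (q.strength A B)) ≫
        mulComparison p q (A ⨯ B)) ≫ (p.tri q).proj _ = d ≫ (p.tri q).hom := by
      rw [← h']; simp only [Category.assoc]
    have h3 : ((a ≫ p.strength A (q.functor.obj B)) ≫ p.functor.map (q.strength A B)) ≫
        p.proj _ = (d ≫ triFst p q) ≫ p.hom := by
      rw [← comp_proj_eq_of_mulComparison h2]; simp only [Category.assoc]
    have h4 : (a ≫ p.strength A (q.functor.obj B)) ≫ p.proj _ = (d ≫ triFst p q) ≫ p.hom := by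
      rw [← h3, Category.assoc _ (p.functor.map _), map_proj]
    -- The first evaluation uses up the strength of `p` and leaves that of `q`, to be resolved by
    -- the second evaluation.
    have e₁ : p.evAt (a ≫ p.strength A (q.functor.obj B) ≫ p.functor.map (q.strength A B))
        (d ≫ triFst p q) (comp_proj_eq_of_mulComparison h2) =
        prod.lift (a ≫ prod.fst) (p.evAt x (d ≫ triFst p q) hx) ≫ q.strength A B := by
      rw [evAt_congr p (Category.assoc _ _ _).symm, evAt_map p _ _ _ h4,
        evAt_strength p _ _ _ hx]
    have e₂ : (a ≫ prod.map (𝟙 A) (mulComparison p q B)) ≫ prod.snd = x ≫ mulComparison p q B := by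
      simp [x]
    have h5 := evAt_comp_proj_eq_of_mulComparison h1
    rw [evAt_congr _ (Category.assoc _ _ _).symm h, evAt_strength _ _ _ _ (by rw [e₂, h1]),
      evAt_congr _ e₂, evAt_mulComparison _ _ h1,
      evAt_congr _ (show _ = (a ≫ p.strength A (q.functor.obj B) ≫
        p.functor.map (q.strength A B)) ≫ mulComparison p q (A ⨯ B) by
          simp only [Category.assoc]) h', evAt_mulComparison _ _ h2, evAt_congr q e₁,
      evAt_strength q _ _ _ (by rw [prod.lift_snd, h5]), evAt_congr q (prod.lift_snd _ _)]
    simp [prod.lift_fst]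

lemma y_base_hom_ext {T : E} (f g : T ⟶ (y E).base) : f = g :=
  terminal.hom_ext _ _

lemma y_total_hom_ext {T : E} (f g : T ⟶ (y E).total) : f = g :=
  terminal.hom_ext _ _

lemma evAt_unitComparison {A T : E} (x : T ⟶ A) (d : T ⟶ (y E).total)
    (h : (x ≫ unitComparison A) ≫ (y E).proj A = d ≫ (y E).hom) :
    (y E).evAt (x ≫ unitComparison A) d h = x :=
  (evAt_lift _ _ _ _ _ _).trans (pullback.lift_fst _ _ _)

lemma unitComparison_naturality {A B : E} (k : A ⟶ B) :
    k ≫ unitComparison B = unitComparison A ≫ (y E).functor.map k := by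
  refine (y E).functor_hom_ext _ _ (y_base_hom_ext _ _) fun S a d h h' => ?_
  rw [evAt_congr _ (Category.assoc _ _ _).symm h, evAt_unitComparison,
    evAt_congr _ (Category.assoc _ _ _).symm h', evAt_map _ _ _ _ (y_base_hom_ext _ _),
    evAt_unitComparison]

lemma unitComparison_strength (A B : E) :
    prod.map (𝟙 A) (unitComparison B) ≫ (y E).strength A B = unitComparison (A ⨯ B) := by
  refine (y E).functor_hom_ext _ _ (y_base_hom_ext _ _) fun S a d h h' => ?_
  have e : (a ≫ prod.map (𝟙 A) (unitComparison B)) ≫ prod.snd =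
      (a ≫ prod.snd) ≫ unitComparison B := by simp
  rw [evAt_unitComparison, evAt_congr _ (Category.assoc _ _ _).symm h,
    evAt_strength _ _ _ _ (y_base_hom_ext _ _), evAt_congr _ e, evAt_unitComparison]
  apply prod.hom_ext <;> simp [prod.lift_fst, prod.lift_snd]

/-- The polynomial `y` has one position and one direction, so an element of `y(A)` is its value at
that direction; evaluation there is the inverse. -/
instance isIso_unitComparison (A : E) : IsIso (unitComparison A) := by
  obtain ⟨t⟩ : Nonempty ((y E).functor.obj A ⟶ (y E).total) := ⟨terminal.from _⟩
  refine ⟨(y E).evAt (𝟙 _) t (y_base_hom_ext _ _), ?_, ?_⟩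
  · rw [comp_evAt]
    refine Eq.trans (evAt_congr _ ((Category.comp_id _).trans (Category.id_comp _).symm) _)
      (evAt_unitComparison (𝟙 A) _ (y_base_hom_ext _ _))
  · refine (y E).functor_hom_ext _ _ (y_base_hom_ext _ _) fun S a d h h' => ?_
    rw [evAt_congr _ (Category.assoc _ _ _).symm h, evAt_unitComparison, comp_evAt]
    exact evAt_congr₂ _ rfl (y_total_hom_ext _ _) _

end Poly

/-! ### The comparisons as isomorphisms of strong endofunctors. -/

namespace StrongEndofunctor

/-- A strong natural transformation with invertible components is an isomorphism. -/
def isoOfIsIsoApp {F G : StrongEndofunctor E} (α : F ⟶ G)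
    (h : ∀ A, IsIso ((Hom.natTrans α).app A)) : F ≅ G where
  hom := α
  inv :=
    haveI : IsIso (Hom.natTrans α) := NatIso.isIso_of_isIso_app _
    { natTrans := inv (Hom.natTrans α)
      strong := fun A B => by
        -- Moving the inverse across turns the claim into strongness of `α`, after which the two
        -- product maps cancel.
        rw [NatIso.isIso_inv_app, NatIso.isIso_inv_app, IsIso.eq_comp_inv, Category.assoc,
          ← Hom.strong α, ← Category.assoc, prod.map_map]
        simp }
  hom_inv_id :=
    haveI : IsIso (Hom.natTrans α) := NatIso.isIso_of_isIso_app _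
    Hom.ext (IsIso.hom_inv_id (Hom.natTrans α))
  inv_hom_id :=
    haveI : IsIso (Hom.natTrans α) := NatIso.isIso_of_isIso_app _
    Hom.ext (IsIso.inv_hom_id (Hom.natTrans α))

end StrongEndofunctor

/-! ### Transport of the monoidal structure along `P`, and its uniqueness. -/

open MonoidalCategory Functor.LaxMonoidal

/-- The unit comparison as a strong natural transformation. -/
def unitComparisonHom : 𝟙_ (StrongEndofunctor E) ⟶ (Poly.y E).strongFunctor where
  natTrans :=
    { app := unitComparison
      naturality := fun _ _ k => Poly.unitComparison_naturality k }
  strong A B := (Poly.unitComparison_strength A B).trans (Category.id_comp _).symm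

/-- The multiplication comparison as a strong natural transformation. -/
def mulComparisonHom (p q : Poly E) :
    p.strongFunctor ⊗ q.strongFunctor ⟶ (p.tri q).strongFunctor where
  natTrans :=
    { app := mulComparison p q
      naturality := fun _ _ k => Poly.mulComparison_naturality p q k }
  strong A B := Poly.mulComparison_strength p q A B

/-- The unit comparison is an isomorphism. -/
def unitComparisonIso : 𝟙_ (StrongEndofunctor E) ≅ (polyFunctor E).obj (Poly.y E) :=
  StrongEndofunctor.isoOfIsIsoApp unitComparisonHom Poly.isIso_unitComparison

/-- The multiplication comparison is an isomorphism. -/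
def mulComparisonIso (p q : Poly E) :
    (polyFunctor E).obj p ⊗ (polyFunctor E).obj q ≅ (polyFunctor E).obj (p.tri q) :=
  StrongEndofunctor.isoOfIsIsoApp (mulComparisonHom p q) Poly.isIso_mulComparison

/-- The data of a monoidal structure on polynomials are determined by their images under the functor `P`. -/
lemma TriStruct.ext_map {S S' : TriStruct E}
    (hl : ∀ (p : Poly E) {q q' : Poly E} (ψ : q ⟶ q'),
      (polyFunctor E).map (S.whiskerLeft p ψ) = (polyFunctor E).map (S'.whiskerLeft p ψ))
    (hr : ∀ {p p' : Poly E} (φ : p ⟶ p') (q : Poly E),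
      (polyFunctor E).map (S.whiskerRight φ q) = (polyFunctor E).map (S'.whiskerRight φ q))
    (ht : ∀ {p p' q q' : Poly E} (φ : p ⟶ p') (ψ : q ⟶ q'),
      (polyFunctor E).map (S.tensorHom φ ψ) = (polyFunctor E).map (S'.tensorHom φ ψ))
    (ha : ∀ p q r : Poly E,
      (polyFunctor E).map (S.associator p q r).hom = (polyFunctor E).map (S'.associator p q r).hom)
    (hlu : ∀ p : Poly E,
      (polyFunctor E).map (S.leftUnitor p).hom = (polyFunctor E).map (S'.leftUnitor p).hom)
    (hru : ∀ p : Poly E,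
      (polyFunctor E).map (S.rightUnitor p).hom = (polyFunctor E).map (S'.rightUnitor p).hom) :
    S = S' := by
  obtain ⟨l, r, t, a, lu, ru⟩ := S
  obtain ⟨l', r', t', a', lu', ru'⟩ := S'
  obtain rfl : @l = @l' := by
    funext p q q' ψ; exact (polyFunctor E).map_injective (hl p ψ)
  obtain rfl : @r = @r' := by
    funext p p' φ q; exact (polyFunctor E).map_injective (hr φ q)
  obtain rfl : @t = @t' := by
    funext p p' q q' φ ψ; exact (polyFunctor E).map_injective (ht φ ψ)
  obtain rfl : a = a' := by
    funext p q r; exact Iso.ext ((polyFunctor E).map_injective (ha p q r))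
  obtain rfl : lu = lu' := by
    funext p; exact Iso.ext ((polyFunctor E).map_injective (hlu p))
  obtain rfl : ru = ru' := by
    funext p; exact Iso.ext ((polyFunctor E).map_injective (hru p))
  rfl

/-- The axioms form a proposition, so only the data can differ. -/
lemma TriMonoidal.ext_toTriStruct {M M' : TriMonoidal E}
    (h : M.toTriStruct = M'.toTriStruct) : M = M' := by
  obtain ⟨S, _⟩ := M
  obtain ⟨S', _⟩ := M'
  obtain rfl : S = S' := h
  rfl

variable (E) in
/-- The monoidal structure data on polynomials obtained from composition of strong endofunctors
along the fully faithful functor `P` and the comparison isomorphisms. -/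
def triStruct : TriStruct E where
  -- Each datum is the preimage of the corresponding one for composition, conjugated by the
  -- comparisons; the coherence laws of a monoidal functor permit no other choice.
  whiskerLeft p {q q'} ψ := (polyFunctor E).preimage ((mulComparisonIso p q).inv ≫
    ((polyFunctor E).obj p ◁ (polyFunctor E).map ψ) ≫ (mulComparisonIso p q').hom)
  whiskerRight {p p'} φ q := (polyFunctor E).preimage ((mulComparisonIso p q).inv ≫
    ((polyFunctor E).map φ ▷ (polyFunctor E).obj q) ≫ (mulComparisonIso p' q).hom)
  tensorHom {p p' q q'} φ ψ := (polyFunctor E).preimage ((mulComparisonIso p q).inv ≫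
    ((polyFunctor E).map φ ⊗ₘ (polyFunctor E).map ψ) ≫ (mulComparisonIso p' q').hom)
  associator p q r := (polyFunctor E).preimageIso
    (((mulComparisonIso _ _).symm ≪≫ ((mulComparisonIso _ _).symm ⊗ᵢ .refl _)) ≪≫
      α_ ((polyFunctor E).obj p) ((polyFunctor E).obj q) ((polyFunctor E).obj r) ≪≫
        ((.refl _ ⊗ᵢ mulComparisonIso _ _) ≪≫ mulComparisonIso _ _))
  leftUnitor p := (polyFunctor E).preimageIso
    (((mulComparisonIso _ _).symm ≪≫ (unitComparisonIso.symm ⊗ᵢ .refl _)) ≪≫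
      λ_ ((polyFunctor E).obj p))
  rightUnitor p := (polyFunctor E).preimageIso
    (((mulComparisonIso _ _).symm ≪≫ (.refl _ ⊗ᵢ unitComparisonIso.symm)) ≪≫
      ρ_ ((polyFunctor E).obj p))

variable (E) in
/-- The functor `P` preserves the data of `triStruct`. -/
def inducingData :
    letI := (triStruct E).toStruct
    Monoidal.InducingFunctorData (polyFunctor E) :=
  letI := (triStruct E).toStruct
  { μIso := mulComparisonIso
    εIso := unitComparisonIso
    whiskerLeft_eq := fun _ _ _ _ => Functor.map_preimage _ _
    whiskerRight_eq := fun _ _ => Functor.map_preimage _ _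
    tensorHom_eq := fun _ _ => Functor.map_preimage _ _
    associator_eq := fun _ _ _ => Functor.map_preimage _ _
    leftUnitor_eq := fun _ => Functor.map_preimage _ _
    rightUnitor_eq := fun _ => Functor.map_preimage _ _ }

variable (E) in
/-- The monoidal structure on polynomials induced from strong endofunctors. -/
def triMonoidal : TriMonoidal E where
  toTriStruct := triStruct E
  isMonoidal :=
    letI := (triStruct E).toStruct
    -- Induction along the faithful functor supplies the axioms and keeps the given data, so the
    -- required equality is definitional.
    ⟨Monoidal.induced (polyFunctor E) (inducingData E), rfl⟩

variable (E) in
/-- The functor `P` is monoidal for the induced structure. -/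
@[reducible]
def polyFunctorMonoidal :
    letI := (triMonoidal E).monoidalCategory
    (polyFunctor E).Monoidal :=
  letI := (triStruct E).toStruct
  Monoidal.fromInducedMonoidal (polyFunctor E) (inducingData E)

/-- A monoidal structure for which `P` is monoidal with the canonical comparisons has the data of
`triStruct`. -/
lemma TriMonoidal.toTriStruct_eq (M : TriMonoidal E)
    (m : letI := M.monoidalCategory; (polyFunctor E).Monoidal)
    (hε : letI := M.monoidalCategory; ε (polyFunctor E) = unitComparisonIso.hom)
    (hμ : letI := M.monoidalCategory;
      ∀ p q, μ (polyFunctor E) p q = (mulComparisonIso p q).hom) :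
    M.toTriStruct = triStruct E := by
  let := M.monoidalCategory
  refine TriStruct.ext_map ?_ ?_ ?_ ?_ ?_ ?_
  · intro p q q' ψ
    refine Eq.trans ?_ (Functor.map_preimage _ _).symm
    rw [Iso.eq_inv_comp]
    -- Naturality of `μ`, with `μ` invertible, determines the image of the whiskering; the next two
    -- cases are alike.
    have h := μ_natural_right (polyFunctor E) p ψ
    rw [hμ, hμ] at h
    exact h.symm
  · intro p p' φ q
    refine Eq.trans ?_ (Functor.map_preimage _ _).symm
    rw [Iso.eq_inv_comp]
    have h := μ_natural_left (polyFunctor E) φ q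
    rw [hμ, hμ] at h
    exact h.symm
  · intro p p' q q' φ ψ
    refine Eq.trans ?_ (Functor.map_preimage _ _).symm
    rw [Iso.eq_inv_comp]
    have h := μ_natural (polyFunctor E) φ ψ
    rw [hμ, hμ] at h
    exact h.symm
  · intro p q r
    refine Eq.trans ?_ (Functor.map_preimage _ _).symm
    -- The associativity axiom becomes a formula for the image of the associator once `μ` and its
    -- whiskering are cancelled. The unitors are treated in the same way, using `ε`.
    have h := associativity (polyFunctor E) p q r
    simp only [hμ] at h
    simp only [Iso.trans_hom, Iso.symm_hom, tensorIso_hom, Iso.refl_hom, tensorHom_id,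
      id_tensorHom, Category.assoc]
    rw [Iso.eq_inv_comp]
    refine Eq.trans ?_ (congrArg (fun k => ((mulComparisonIso p q).inv ▷ _) ≫ k) h)
    rw [inv_hom_whiskerRight_assoc]
    rfl
  · intro p
    refine Eq.trans ?_ (Functor.map_preimage _ _).symm
    have h := left_unitality (polyFunctor E) p
    rw [hμ, hε] at h
    simp only [Iso.trans_hom, Iso.symm_hom, tensorIso_hom, Iso.refl_hom, tensorHom_id,
      Category.assoc]
    rw [Iso.eq_inv_comp, h, inv_hom_whiskerRight_assoc]
    rfl
  · intro p
    refine Eq.trans ?_ (Functor.map_preimage _ _).symm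
    have h := right_unitality (polyFunctor E) p
    rw [hμ, hε] at h
    simp only [Iso.trans_hom, Iso.symm_hom, tensorIso_hom, Iso.refl_hom, id_tensorHom,
      Category.assoc]
    rw [Iso.eq_inv_comp, h, whiskerLeft_inv_hom_assoc]
    rfl

end CatPoly

end

theorem mainTheorem6 {E : Type u} [Category.{v} E] [HasFiniteLimits E] :
    (CatPoly.polyFunctor E).Full ∧ (CatPoly.polyFunctor E).Faithful ∧
      ∃! M : CatPoly.TriMonoidal E,
        letI := M.monoidalCategory
        ∃ _m : (CatPoly.polyFunctor E).Monoidal,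
          (∀ A : E, (Functor.LaxMonoidal.ε (CatPoly.polyFunctor E)).natTrans.app A =
            CatPoly.unitComparison A) ∧
          (∀ (p q : CatPoly.Poly E) (A : E),
            (Functor.LaxMonoidal.μ (CatPoly.polyFunctor E) p q).natTrans.app A =
              CatPoly.mulComparison p q A) := by
  refine ⟨inferInstance, inferInstance, CatPoly.triMonoidal E,
    ⟨CatPoly.polyFunctorMonoidal E, fun _ => rfl, fun _ _ _ => rfl⟩, ?_⟩
  -- For uniqueness, the componentwise conditions identify `ε` and `μ` as strong transformations,
  -- since these are determined by their components.
  rintro M ⟨m, hε, hμ⟩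
  exact CatPoly.TriMonoidal.ext_toTriStruct (M.toTriStruct_eq m
    (CatPoly.StrongEndofunctor.hom_ext hε)
    (fun p q => CatPoly.StrongEndofunctor.hom_ext (hμ p q)))
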